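/- Let $\alpha\ge 1$ be real. Let $(\delta_m)_{m<\omega}$ be a sequence in $(0,1)$ with $0<\inf_m\delta_m\le\sup_m\delta_m<1$, and let $(k_m)_{m<\omega}$ be an increasing sequence of integers $\ge 2$ with $k_{m+1}\ge 2k_m$ for all $m$. Put $a_0=0$, $a_{l}=a_{l-1}+1+(l-1)a_{l-1}$ for $l>0$, and $I_l=[a_l,a_{l+1})\cap\omega$. For $U\subseteq\omega$ define $u_U(0)=1$ and, for $n>0$, $u_U(n)=\delta_m u_U(n-1)$ if $n=k_m$ with $m\in I_l$ for some $l\in U$, and $u_U(n)=u_U(n-1)$ otherwise. Let $\varphi:[0,1]\to[0,\infty)$ be continuous with $\varphi(x)>0$ for $x>0$, and essentially increasing (there is $C\ge1$ with $\varphi(x)\le C\varphi(y)$ whenever $x\le y$), and suppose that there is $\lambda>0$ with $\varphi(x^2)\ge\lambda\varphi(x)$ for all $x\in[0,1]$. For every $U\subseteq\omega$ let $\varphi_U:[0,1]\to[0,\infty)$ be a continuous (weakly) increasing function with $\varphi_U(1/2^n)=u_U(n)$ for all $n<\omega$, and set $f_U(x)=x^\alpha\varphi(x)\varphi_U(x)$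 for $x\in[0,1]$. For $f:[0,1]\to[0,\infty)$ let $\mathbf{E}_f$ be the relation on $[0,1]^\omega$ given by $(x_n)\,\mathbf{E}_f\,(y_n)\iff\sum_{n<\omega}f(|y_n-x_n|)<\infty$. For relations $E,F$ on Polish spaces $X,Y$ write $E\le_B F$ if there is a Borel map $\theta:X\to Y$ with $x\,E\,y\iff\theta(x)\,F\,\theta(y)$ for all $x,y\in X$; write $E<_BF$ if $E\le_BF$ and $F\not\le_BE$; and call $E,F$ Borel incomparable if $E\not\le_BF$ and $F\not\le_BE$. Write $U\subseteq^*V$ if $U\setminus V$ is finite. Then $\mathbf{E}_{f_U}$ is an equivalence relation for every $U\subseteq\omega$, and for all $U,V\subseteq\omega$: \[ U\subseteq^*V\iff \mathbf{E}_{f_U}\le_B\mathbf{E}_{f_V}. \] More precisely: if $U\subseteq^*V$ and $V\subseteq^*U$, then $\mathbf{E}_{f_U}=\mathbf{E}_{f_V}$; if $U\subseteq^*V$ and $V\setminus U$ is infinite, then $\mathbf{E}_{f_U}<_B\mathbf{E}_{f_V}$; and if $U\setminus V$ and $V\setminus U$ are both infinite, then $\mathbf{E}_{f_U}$ and $\mathbf{E}_{f_V}$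 are Borel incomparable. -/

import Mathlib

open scoped NNReal unitInterval

noncomputable section

/-- `f` is essentially increasing: for some `C ≥ 1`, `x ≤ y` implies `f x ≤ C * f y`. -/
def EssentiallyIncreasing {D : Set ℝ} (f : D → ℝ≥0) : Prop :=
  ∃ C : ℝ≥0, 1 ≤ C ∧ ∀ x y : D, x ≤ y → f x ≤ C * f y

/-- The distance `|y - x|` of two points of `[0,1]`, as a point of `[0,1]`. -/
def unitDist (x y : I) : I :=
  ⟨|(y : ℝ) - x|, abs_nonneg _,
    abs_sub_le_iff.2 ⟨by linarith [y.2.2, x.2.1], by linarith [x.2.2, y.2.1]⟩⟩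

/-- The relation `E_f` on `[0,1]^ω`: the series `∑ f(|y_n - x_n|)` of nonnegative reals
converges. -/
def relE (f : I → ℝ≥0) (x y : ℕ → I) : Prop :=
  Summable fun n => f (unitDist (x n) (y n))

section BorelReducibility

variable {X Y : Type*} [TopologicalSpace X] [PolishSpace X] [MeasurableSpace X] [BorelSpace X]
  [TopologicalSpace Y] [PolishSpace Y] [MeasurableSpace Y] [BorelSpace Y]

/-- Borel reducibility `E ≤_B F` of relations on Polish spaces. -/
def BorelReducible (E : X → X → Prop) (F : Y → Y → Prop) : Prop :=
  ∃ θ : X → Y, Measurable θ ∧ ∀ x y, E x y ↔ F (θ x) (θ y)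

/-- Strict Borel reducibility `E <_B F`. -/
def StrictlyBorelReducible (E : X → X → Prop) (F : Y → Y → Prop) : Prop :=
  BorelReducible E F ∧ ¬ BorelReducible F E

/-- Neither of the two relations is Borel reducible to the other. -/
def BorelIncomparable (E : X → X → Prop) (F : Y → Y → Prop) : Prop :=
  ¬ BorelReducible E F ∧ ¬ BorelReducible F E

end BorelReducibility

/-- `U ⊆* V`: the difference `U \ V` is finite. -/
def AlmostSubset (U V : Set ℕ) : Prop := (U \ V).Finite

/-- `a 0 = 0` and `a l = a (l-1) + 1 + (l-1) * a (l-1)` for `l > 0`. -/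
def blockStart : ℕ → ℕ
  | 0 => 0
  | l + 1 => blockStart l + 1 + l * blockStart l

/-- The block `I_l = [a l, a (l+1))` of natural numbers. -/
def block (l : ℕ) : Set ℕ := Set.Ico (blockStart l) (blockStart (l + 1))

open Classical in
/-- The sequence `u_U`: it starts with `1`, is multiplied by `δ m` at the index `n = k m` when `m`
lies in a block `I_l` with `l ∈ U`, and is constant otherwise. (The index `m` is unique when `k`
is injective.) -/
def blockSeq (δ : ℕ → ℝ) (k : ℕ → ℕ) (U : Set ℕ) : ℕ → ℝ
  | 0 => 1
  | n + 1 =>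
    if h : ∃ m, n + 1 = k m ∧ ∃ l ∈ U, m ∈ block l then
      δ h.choose * blockSeq δ k U n
    else blockSeq δ k U n

theorem blockSeq_of_mem {δ : ℕ → ℝ} {k : ℕ → ℕ} (hk : Function.Injective k) {U : Set ℕ}
    {n m l : ℕ} (hn : n + 1 = k m) (hl : l ∈ U) (hm : m ∈ block l) :
    blockSeq δ k U (n + 1) = δ m * blockSeq δ k U n := by
  have h : ∃ m, n + 1 = k m ∧ ∃ l ∈ U, m ∈ block l := ⟨m, hn, l, hl, hm⟩
  have e : h.choose = m := hk (h.choose_spec.1.symm.trans hn)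
  rw [blockSeq, dif_pos h, e]

theorem blockSeq_of_not {δ : ℕ → ℝ} {k : ℕ → ℕ} {U : Set ℕ} {n : ℕ}
    (h : ¬ ∃ m, n + 1 = k m ∧ ∃ l ∈ U, m ∈ block l) :
    blockSeq δ k U (n + 1) = blockSeq δ k U n := by
  rw [blockSeq, dif_neg h]

/-- The point `1 / 2 ^ n` of `[0,1]`. -/
def dyadicPt (n : ℕ) : I :=
  ⟨1 / 2 ^ n, by positivity, by
    rw [div_le_one (by positivity)]; exact one_le_pow₀ (by norm_num)⟩

/-- The function `x ↦ x ^ α * φ x * ψ x` on `[0,1]`. -/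
def powMul (α : ℝ) (φ ψ : I → ℝ≥0) (x : I) : ℝ≥0 :=
  unitInterval.toNNReal x ^ α * φ x * ψ x

end

/-! The functions x^α φ(x) φ_U(x) are, up to constants, increasing, doubling, convex and satisfy
F(s)F(t) ≤ A F(st) on [0,1]; `IsGauge` records this. Both directions compare f = f_U and g = f_V at
the points 2^(-n), where f/g = u_U/u_V.

Suppose U \ V is infinite. Block l has 1 + l·a_l elements, so for large l in U \ V the drop of u_U
on it outweighs everything u_V lost before; hence f/g has lower limit 0 along 2^(-n)
(`exists_blockProd_le_eps_mul`). This excludes a Borel reduction θ (`not_borelReducible_of_liminf`).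
By Baire category, θ restricted to a product of finite grids is, up to finite error, a direct sum of
maps p_i of one grid each (`exists_block_decomposition`, `exists_diagonal`). The meshes 2^(-N) are
chosen so that ∑ f(2^(-N)) < ∞ = ∑ g(2^(-N)). If the p_i-images of the endpoints 0 and 1 come
arbitrarily close, E_g identifies sequences that E_f separates. Otherwise convexity yields on each
grid one step whose image has g-size at least a constant times g(2^(-N)) (`IsGauge.exists_step`);
changing along these steps is E_f-trivial but not E_g-trivial.

Suppose U ⊆* V. Finite changes of U alter f only by bounded factors, so U may be replaced by U ∩ V,
and then w = u_U/u_V increases with jumps proportional to w. Waves at scale 2^(-n) move by about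
min(|x - y|, 2^(-n)). Taking about w(n+1) - w(n) copies of the waves at scale 2^(-(n+1)), the g-sum
for points at distance t ≈ 2^(-N) is about w(N) g(t) ≈ f(t), the finer scales adding a geometric
tail (`borelReducible_of_ratio`). -/

/-! ### Gauges: convexity-type inequalities up to a constant -/

/-- A function on `[0, ∞)` which, up to the constant `A`, is increasing, doubling,
submultiplicative on `[0,1]`, and has supporting lines. -/
structure IsGauge (F : ℝ → ℝ) (A : ℝ) : Prop where
  one_le : 1 ≤ A
  zero : F 0 = 0
  pos : ∀ t, 0 < t → 0 < F t
  mono : ∀ s t, 0 ≤ s → s ≤ t → F s ≤ A * F t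
  double : ∀ t, 0 ≤ t → F (2 * t) ≤ A * F t
  mul : ∀ s t, 0 ≤ s → s ≤ 1 → 0 ≤ t → t ≤ 1 → F s * F t ≤ A * F (s * t)
  supp : ∀ a, 0 ≤ a → ∃ q, 0 ≤ q ∧ F a ≤ A * (q * (a / 2)) ∧
    ∀ d, 0 ≤ d → q * (d - a / 2) ≤ F d

namespace IsGauge

variable {F : ℝ → ℝ} {A : ℝ}

theorem nonneg (h : IsGauge F A) {t : ℝ} (ht : 0 ≤ t) : 0 ≤ F t := by
  rcases ht.eq_or_lt with rfl | ht
  · exact h.zero.ge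
  · exact (h.pos t ht).le

theorem add_le (h : IsGauge F A) {s t : ℝ} (hs : 0 ≤ s) (ht : 0 ≤ t) :
    F (s + t) ≤ A ^ 2 * (F s + F t) := by
  have hA := h.one_le
  have key : ∀ s t, 0 ≤ s → s ≤ t → F (s + t) ≤ A ^ 2 * (F s + F t) := by
    intro s t hs hst
    have h1 := h.mono (s + t) (2 * t) (by linarith) (by linarith)
    have h2 := h.double t (by linarith)
    have h3 := h.nonneg hs
    have h4 : A * F (2 * t) ≤ A * (A * F t) := by gcongr
    have h5 : 0 ≤ A ^ 2 * F s := by positivity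
    nlinarith
  rcases le_total s t with hst | hst
  · exact key s t hs hst
  · rw [add_comm s, add_comm (F s)]
    exact key t s ht hst

theorem abs_sub_le (h : IsGauge F A) (x y z : ℝ) :
    F |z - x| ≤ A ^ 3 * (F |y - x| + F |z - y|) := by
  have hA := h.one_le
  have h1 := h.mono |z - x| (|y - x| + |z - y|) (abs_nonneg _)
    (by rw [add_comm]; exact _root_.abs_sub_le z y x)
  have h2 := h.add_le (abs_nonneg (y - x)) (abs_nonneg (z - y))
  have h4 : A * F (|y - x| + |z - y|) ≤ A * (A ^ 2 * (F |y - x| + F |z - y|)) := by gcongr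
  calc _ ≤ _ := h1
    _ ≤ _ := h4
    _ = _ := by ring

/-- Summing the supporting line over the d_i gives ∑ F(d_i) ≥ q(Ka - Ka/2) = qKa/2. The line
vanishes at a/2 rather than touching the graph at a, which suffices for a function only comparable
to a convex one. -/
theorem jensen (h : IsGauge F A) {K : ℕ} {a : ℝ} (ha : 0 ≤ a) (d : ℕ → ℝ) (hd : ∀ i, 0 ≤ d i)
    (hsum : K * a ≤ ∑ i ∈ Finset.range K, d i) :
    K * F a ≤ A * ∑ i ∈ Finset.range K, F (d i) := by
  obtain ⟨q, hq, h1, h2⟩ := h.supp a ha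
  have hA := h.one_le
  have h3 : ∑ i ∈ Finset.range K, q * (d i - a / 2) ≤ ∑ i ∈ Finset.range K, F (d i) :=
    Finset.sum_le_sum fun i _ => h2 _ (hd i)
  rw [← Finset.mul_sum, Finset.sum_sub_distrib] at h3
  simp only [Finset.sum_const, Finset.card_range, nsmul_eq_mul] at h3
  have h4 : q * (K * (a / 2)) ≤ ∑ i ∈ Finset.range K, F (d i) :=
    le_trans (mul_le_mul_of_nonneg_left (by linarith) hq) h3
  calc K * F a ≤ K * (A * (q * (a / 2))) := by gcongr
    _ = A * (q * (K * (a / 2))) := by ring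
    _ ≤ _ := by gcongr

/-- The mean step is at least t/K with t = |p K - p 0|, so `jensen` applies at t/K, and F(t/K) is
bounded below by F(t)F(1/K)/A. -/
theorem chain_le (h : IsGauge F A) {K : ℕ} (hK : 0 < K) (p : ℕ → ℝ)
    (hp : |p K - p 0| ≤ 1) :
    K * (F |p K - p 0| * F (1 / K)) ≤
      A ^ 2 * ∑ i ∈ Finset.range K, F |p (i + 1) - p i| := by
  have hA := h.one_le
  have hK' : (1 : ℝ) ≤ K := by exact_mod_cast hK
  have hK0 : (0 : ℝ) < K := by linarith
  set t := |p K - p 0| with ht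
  have ht0 : 0 ≤ t := abs_nonneg _
  have h1 := h.mul t (1 / K) ht0 hp (by positivity) ((div_le_one hK0).2 hK')
  have h2 := h.jensen (K := K) (a := t * (1 / K)) (by positivity) (fun i => |p (i + 1) - p i|)
    (fun i => abs_nonneg _) (by
      have : (K : ℝ) * (t * (1 / K)) = t := by field_simp
      rw [this, ht, ← Finset.sum_range_sub]
      exact Finset.abs_sum_le_sum_abs _ _)
  calc K * (F t * F (1 / K)) ≤ K * (A * F (t * (1 / K))) := by gcongr
    _ = A * (K * F (t * (1 / K))) := by ring
    _ ≤ A * (A * ∑ i ∈ Finset.range K, F |p (i + 1) - p i|) := by gcongr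
    _ = _ := by ring

theorem weaken (h : IsGauge F A) {B : ℝ} (hAB : A ≤ B) : IsGauge F B where
  one_le := h.one_le.trans hAB
  zero := h.zero
  pos := h.pos
  mono s t hs hst := (h.mono s t hs hst).trans
    (mul_le_mul_of_nonneg_right hAB (h.nonneg (hs.trans hst)))
  double t ht := (h.double t ht).trans (mul_le_mul_of_nonneg_right hAB (h.nonneg ht))
  mul s t hs hs1 ht ht1 := (h.mul s t hs hs1 ht ht1).trans
    (mul_le_mul_of_nonneg_right hAB (h.nonneg (mul_nonneg hs ht)))
  supp a ha := by
    obtain ⟨q, hq, h1, h2⟩ := h.supp a ha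
    exact ⟨q, hq, h1.trans (mul_le_mul_of_nonneg_right hAB (by positivity)), h2⟩

end IsGauge

/-! ### Slowly varying weights give gauges -/

/-- Continuous positive weights on `[0,1]` that are essentially increasing and vary slowly
at `0`. -/
structure IsSlowWeight (h : I → ℝ≥0) : Prop where
  cont : Continuous h
  pos : ∀ x : I, 0 < x → 0 < h x
  ess : EssentiallyIncreasing h
  sq : ∃ c : ℝ≥0, 0 < c ∧ ∀ x : I, c * h x ≤ h (x ^ 2)

theorem IsSlowWeight.mul {g h : I → ℝ≥0} (hg : IsSlowWeight g) (hh : IsSlowWeight h) :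
    IsSlowWeight fun x => g x * h x where
  cont := hg.cont.mul hh.cont
  pos x hx := mul_pos (hg.pos x hx) (hh.pos x hx)
  ess := by
    obtain ⟨C, hC, h1⟩ := hg.ess
    obtain ⟨D, hD, h2⟩ := hh.ess
    refine ⟨C * D, one_le_mul_of_one_le_of_one_le hC hD, fun x y hxy => ?_⟩
    calc g x * h x ≤ (C * g y) * (D * h y) := mul_le_mul' (h1 x y hxy) (h2 x y hxy)
      _ = _ := by ring
  sq := by
    obtain ⟨c, hc, h1⟩ := hg.sq
    obtain ⟨d, hd, h2⟩ := hh.sq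
    refine ⟨c * d, mul_pos hc hd, fun x => ?_⟩
    calc c * d * (g x * h x) = (c * g x) * (d * h x) := by ring
      _ ≤ _ := mul_le_mul' (h1 x) (h2 x)

/-- The extension of `h : [0,1] → [0,∞)` to the real line that is constant on both sides. -/
noncomputable def realExt (h : I → ℝ≥0) (t : ℝ) : ℝ := h (Set.projIcc 0 1 zero_le_one t)

theorem realExt_nonneg (h : I → ℝ≥0) (t : ℝ) : 0 ≤ realExt h t := NNReal.coe_nonneg _

theorem realExt_coe (h : I → ℝ≥0) (x : I) : realExt h x = h x := by
  rw [realExt, Set.projIcc_val]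

theorem realExt_of_one_le (h : I → ℝ≥0) {t : ℝ} (ht : 1 ≤ t) : realExt h t = realExt h 1 := by
  rw [realExt, realExt, Set.projIcc_of_right_le _ ht, Set.projIcc_right]

namespace IsSlowWeight

variable {h : I → ℝ≥0}

theorem realExt_pos (hh : IsSlowWeight h) {t : ℝ} (ht : 0 < t) : 0 < realExt h t := by
  refine NNReal.coe_pos.2 (hh.pos _ ?_)
  rw [← Subtype.coe_lt_coe, Set.coe_projIcc]
  simp [ht]

theorem exists_realExt_le (hh : IsSlowWeight h) :
    ∃ C : ℝ, 1 ≤ C ∧ ∀ s t : ℝ, s ≤ t → realExt h s ≤ C * realExt h t := by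
  obtain ⟨C, hC, h1⟩ := hh.ess
  refine ⟨C, by exact_mod_cast hC, fun s t hst => ?_⟩
  exact_mod_cast h1 _ _ (Set.monotone_projIcc _ hst)

/-- For s ≤ t one has s² ≤ st, so h(s) is bounded by h(s²), hence by h(st), while h(t) is bounded by
h(1). -/
theorem exists_realExt_mul_le (hh : IsSlowWeight h) :
    ∃ A : ℝ, 0 ≤ A ∧ ∀ s t : ℝ, 0 ≤ s → s ≤ 1 → 0 ≤ t → t ≤ 1 →
      realExt h s * realExt h t ≤ A * realExt h (s * t) := by
  obtain ⟨C, hC, h1⟩ := hh.exists_realExt_le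
  obtain ⟨c, hc, h2⟩ := hh.sq
  have hc' : (0 : ℝ) < c := hc
  have hsq : ∀ s : ℝ, 0 ≤ s → s ≤ 1 → c * realExt h s ≤ realExt h (s * s) := by
    intro s hs hs1
    have := h2 ⟨s, hs, hs1⟩
    rw [← NNReal.coe_le_coe, NNReal.coe_mul, ← realExt_coe, ← realExt_coe] at this
    rw [← pow_two]
    simpa using this
  have key : ∀ s t : ℝ, 0 ≤ s → s ≤ t → t ≤ 1 →
      realExt h s * realExt h t ≤ C * realExt h 1 * C / c * realExt h (s * t) := by
    intro s t hs hst ht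
    have e1 := hsq s hs (hst.trans ht)
    have e2 := h1 (s * s) (s * t) (by gcongr)
    have e3 := h1 t 1 ht
    have e4 : realExt h s ≤ C * realExt h (s * t) / c := by
      rw [le_div_iff₀ hc']; linarith
    calc realExt h s * realExt h t ≤ (C * realExt h (s * t) / c) * (C * realExt h 1) :=
          mul_le_mul e4 e3 (realExt_nonneg _ _)
            (by have := realExt_nonneg h (s * t); positivity)
      _ = _ := by ring
  have := realExt_nonneg h 1
  refine ⟨C * realExt h 1 * C / c, by positivity, fun s t hs hs1 ht ht1 => ?_⟩
  rcases le_total s t with hst | hst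
  · exact key s t hs hst ht1
  · rw [mul_comm (realExt h s), mul_comm s]
    exact key t s ht hst hs1

/-- Below 1/2 this is the product inequality for the factors 1/2 and 2t; above 1/2 the weight lies
between positive constants. -/
theorem exists_realExt_double_le (hh : IsSlowWeight h) :
    ∃ D : ℝ, 0 ≤ D ∧ ∀ t : ℝ, 0 ≤ t → realExt h (2 * t) ≤ D * realExt h t := by
  obtain ⟨C, hC, h1⟩ := hh.exists_realExt_le
  obtain ⟨A, hA, h2⟩ := hh.exists_realExt_mul_le
  have hp := hh.realExt_pos (t := 1 / 2) (by norm_num)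
  have h10 := realExt_nonneg h 1
  refine ⟨A / realExt h (1 / 2) + C * realExt h 1 / realExt h (1 / 2), by positivity,
    fun t ht => ?_⟩
  have ht0 := realExt_nonneg h t
  rw [add_mul]
  rcases le_total (2 * t) 1 with h3 | h3
  · have h4 := h2 (1 / 2) (2 * t) (by norm_num) (by norm_num) (by linarith) h3
    rw [show 1 / 2 * (2 * t) = t by ring] at h4
    have h5 : realExt h (2 * t) ≤ A / realExt h (1 / 2) * realExt h t := by
      rw [div_mul_eq_mul_div, le_div_iff₀ hp]; linarith
    have : 0 ≤ C * realExt h 1 / realExt h (1 / 2) * realExt h t := by positivity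
    linarith
  · rw [realExt_of_one_le h h3]
    have h4 := h1 (1 / 2) t (by linarith)
    have h5 : realExt h 1 ≤ C * realExt h 1 / realExt h (1 / 2) * realExt h t := by
      rw [div_mul_eq_mul_div, le_div_iff₀ hp]; nlinarith
    have : 0 ≤ A / realExt h (1 / 2) * realExt h t := by positivity
    linarith

theorem exists_isGauge (hh : IsSlowWeight h) {α : ℝ} (hα : 1 ≤ α) :
    ∃ A, IsGauge (fun t => t ^ α * realExt h t) A := by
  obtain ⟨C, hC, h1⟩ := hh.exists_realExt_le
  obtain ⟨A, hA, h2⟩ := hh.exists_realExt_mul_le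
  obtain ⟨D, hD, h3⟩ := hh.exists_realExt_double_le
  have hα0 : 0 < α := by linarith
  have h2α : (1 : ℝ) ≤ 2 ^ α := Real.one_le_rpow (by norm_num) hα0.le
  have hH := realExt_nonneg h
  have hd : ∀ t : ℝ, 0 ≤ t → (2 * t) ^ α * realExt h (2 * t) ≤
      2 ^ α * D * (t ^ α * realExt h t) := by
    intro t ht
    rw [Real.mul_rpow (by norm_num) ht]
    calc 2 ^ α * t ^ α * realExt h (2 * t) ≤ 2 ^ α * t ^ α * (D * realExt h t) := by
          gcongr; exact h3 t ht
      _ = _ := by ring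
  have hF : ∀ t : ℝ, 0 ≤ t → 0 ≤ t ^ α * realExt h t := fun t ht =>
    mul_nonneg (Real.rpow_nonneg ht _) (hH t)
  have hCD : 0 ≤ C * (2 ^ α * D) := by positivity
  have hDp : 0 ≤ 2 ^ α * D := by positivity
  refine ⟨C + A + 2 ^ α * D + C * (2 ^ α * D), by linarith, ?_, ?_, ?_, ?_, ?_, ?_⟩
  · simp [Real.zero_rpow hα0.ne']
  · exact fun t ht => mul_pos (Real.rpow_pos_of_pos ht _) (hh.realExt_pos ht)
  · intro s t hs hst
    calc s ^ α * realExt h s ≤ t ^ α * (C * realExt h t) := by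
          refine mul_le_mul (Real.rpow_le_rpow hs hst hα0.le) (h1 s t hst) (hH s)
            (Real.rpow_nonneg (hs.trans hst) _)
      _ = C * (t ^ α * realExt h t) := by ring
      _ ≤ _ := mul_le_mul_of_nonneg_right (by linarith) (hF t (hs.trans hst))
  · intro t ht
    exact (hd t ht).trans (mul_le_mul_of_nonneg_right (by linarith) (hF t ht))
  · intro s t hs hs1 ht ht1
    calc s ^ α * realExt h s * (t ^ α * realExt h t)
        = (s * t) ^ α * (realExt h s * realExt h t) := by rw [Real.mul_rpow hs ht]; ring
      _ ≤ (s * t) ^ α * (A * realExt h (s * t)) :=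
          mul_le_mul_of_nonneg_left (h2 s t hs hs1 ht ht1) (Real.rpow_nonneg (by positivity) _)
      _ = A * ((s * t) ^ α * realExt h (s * t)) := by ring
      _ ≤ _ := mul_le_mul_of_nonneg_right (by linarith) (hF _ (by positivity))
  · intro a ha
    have hsplit : ∀ d : ℝ, 0 ≤ d → d ^ α = d ^ (α - 1) * d := by
      intro d hd
      rcases hd.eq_or_lt with rfl | hd
      · simp [Real.zero_rpow hα0.ne']
      · rw [Real.rpow_sub_one hd.ne', div_mul_cancel₀ _ hd.ne']
    -- The slope q is F(t)/t at t = a/2, divided by C. As α ≥ 1, F(t)/t is increasing up to C, so qd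
    -- ≤ F(d) for d ≥ a/2; for d ≤ a/2 the line is nonpositive.
    have hq : 0 ≤ (a / 2) ^ (α - 1) * realExt h (a / 2) / C :=
      div_nonneg (mul_nonneg (Real.rpow_nonneg (by positivity) _) (hH _)) (by linarith)
    refine ⟨_, hq, ?_, ?_⟩
    · have e := hd (a / 2) (by positivity)
      rw [show 2 * (a / 2) = a by ring] at e
      calc a ^ α * realExt h a ≤ 2 ^ α * D * ((a / 2) ^ α * realExt h (a / 2)) := e
        _ = C * (2 ^ α * D) * ((a / 2) ^ (α - 1) * realExt h (a / 2) / C * (a / 2)) := by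
            rw [hsplit (a / 2) (by positivity)]; field_simp
        _ ≤ _ := mul_le_mul_of_nonneg_right (by linarith) (by positivity)
    · intro d hd
      rcases le_total d (a / 2) with h4 | h4
      · exact (mul_nonpos_of_nonneg_of_nonpos hq (by linarith)).trans (hF d hd)
      · have e : (a / 2) ^ (α - 1) * realExt h (a / 2) / C ≤ d ^ (α - 1) * realExt h d := by
          rw [div_le_iff₀ (by linarith)]
          calc _ ≤ d ^ (α - 1) * (C * realExt h d) :=
                mul_le_mul (Real.rpow_le_rpow (by positivity) h4 (by linarith)) (h1 _ _ h4) (hH _)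
                  (Real.rpow_nonneg hd _)
            _ = _ := by ring
        calc _ ≤ d ^ (α - 1) * realExt h d * d :=
              mul_le_mul e (by linarith) (by linarith)
                (mul_nonneg (Real.rpow_nonneg hd _) (hH d))
          _ = _ := by rw [hsplit d hd]; ring

end IsSlowWeight

/-! ### Block products and the sequences u_U -/

/-- The indices `m` whose block `I_l` has `l ∈ U`. -/
def blockUnion (U : Set ℕ) : Set ℕ := {m | ∃ l ∈ U, m ∈ block l}

open Classical in
/-- The product of the `δ m` over the indices `m < c` that lie in a block `I_l` with `l ∈ U`. -/
noncomputable def blockProd (δ : ℕ → ℝ) (U : Set ℕ) (c : ℕ) : ℝ :=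
  ∏ m ∈ Finset.range c, if m ∈ blockUnion U then δ m else 1

section blockStart

theorem blockStart_succ (l : ℕ) : blockStart (l + 1) = blockStart l + 1 + l * blockStart l := rfl

theorem blockStart_strictMono : StrictMono blockStart :=
  strictMono_nat_of_lt_succ fun l => by rw [blockStart_succ]; omega

theorem block_finite (l : ℕ) : (block l).Finite := Set.finite_Ico _ _

theorem eq_of_mem_block {m l l' : ℕ} (h : m ∈ block l) (h' : m ∈ block l') : l = l' := by
  have key : ∀ {l l'}, m ∈ block l → m ∈ block l' → ¬ l < l' := fun {l l'} h h' hlt => by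
    have h1 := h.2
    have h2 := h'.1
    have h3 := blockStart_strictMono.monotone (Nat.succ_le_of_lt hlt)
    rw [Nat.succ_eq_add_one] at h3
    omega
  exact le_antisymm (not_lt.1 (key h' h)) (not_lt.1 (key h h'))

theorem finite_blockUnion_diff {U V : Set ℕ} (h : AlmostSubset U V) :
    (blockUnion U \ blockUnion V).Finite := by
  refine (Set.Finite.biUnion h fun l _ => block_finite l).subset ?_
  rintro m ⟨⟨l, hl, hm⟩, hV⟩
  exact Set.mem_biUnion (⟨hl, fun hlV => hV ⟨l, hlV, hm⟩⟩ : l ∈ U \ V) hm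

end blockStart

section blockProd

variable {δ : ℕ → ℝ} {d s : ℝ}

theorem blockProd_zero (U : Set ℕ) : blockProd δ U 0 = 1 := rfl

open Classical in
theorem blockProd_succ (U : Set ℕ) (c : ℕ) :
    blockProd δ U (c + 1) = blockProd δ U c * if c ∈ blockUnion U then δ c else 1 :=
  Finset.prod_range_succ _ _

theorem blockProd_pos (hδ : ∀ m, δ m ∈ Set.Ioo (0 : ℝ) 1) (U : Set ℕ) (c : ℕ) :
    0 < blockProd δ U c := by
  classical
  exact Finset.prod_pos fun m _ => by split_ifs <;> simp [(hδ m).1]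

theorem blockProd_antitone (hδ : ∀ m, δ m ∈ Set.Ioo (0 : ℝ) 1) (U : Set ℕ) :
    Antitone (blockProd δ U) := by
  classical
  refine antitone_nat_of_succ_le fun c => ?_
  rw [blockProd_succ]
  refine mul_le_of_le_one_right (blockProd_pos hδ U c).le ?_
  split_ifs
  exacts [(hδ c).2.le, le_rfl]

theorem blockProd_le_one (hδ : ∀ m, δ m ∈ Set.Ioo (0 : ℝ) 1) (U : Set ℕ) (c : ℕ) :
    blockProd δ U c ≤ 1 := by
  simpa [blockProd_zero] using blockProd_antitone hδ U (Nat.zero_le c)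

theorem pow_mul_blockProd_le (hδ : ∀ m, δ m ∈ Set.Ioo (0 : ℝ) 1) (hd : 0 < d)
    (hdδ : ∀ m, d ≤ δ m) (U : Set ℕ) (c i : ℕ) :
    d ^ i * blockProd δ U c ≤ blockProd δ U (c + i) := by
  classical
  induction i with
  | zero => simp
  | succ i ih =>
    rw [← add_assoc, blockProd_succ, pow_succ, mul_right_comm]
    refine mul_le_mul ih ?_ hd.le (blockProd_pos hδ U _).le
    split_ifs
    exacts [hdδ _, (hdδ 0).trans (hδ 0).2.le]

/-- Past the last index in the blocks of U but not of V, every factor acquired for U is acquired for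
V too; the earlier indices cost at most a fixed power of d. -/
theorem exists_blockProd_le_mul (hδ : ∀ m, δ m ∈ Set.Ioo (0 : ℝ) 1) (hd : 0 < d)
    (hdδ : ∀ m, d ≤ δ m) {U V : Set ℕ} (h : AlmostSubset U V) :
    ∃ C, 0 < C ∧ ∀ c, blockProd δ V c ≤ C * blockProd δ U c := by
  classical
  obtain ⟨M, hM⟩ := (finite_blockUnion_diff h).bddAbove
  have hd1 : d ≤ 1 := (hdδ 0).trans (hδ 0).2.le
  have hp := blockProd_pos hδ
  have key : ∀ c, d ^ (M + 1) * blockProd δ V c ≤ blockProd δ U c := by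
    intro c
    rcases le_total c (M + 1) with hc | hc
    · have h1 := pow_mul_blockProd_le hδ hd hdδ U 0 c
      rw [blockProd_zero, zero_add, mul_one] at h1
      calc d ^ (M + 1) * blockProd δ V c ≤ d ^ (M + 1) * 1 := by
            gcongr; exact blockProd_le_one hδ V c
        _ ≤ d ^ c := by rw [mul_one]; exact pow_le_pow_of_le_one hd.le hd1 hc
        _ ≤ _ := h1
    · induction c, hc using Nat.le_induction with
      | base =>
        have h1 := pow_mul_blockProd_le hδ hd hdδ U 0 (M + 1)
        rw [blockProd_zero, zero_add, mul_one] at h1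
        refine le_trans ?_ h1
        exact mul_le_of_le_one_right (by positivity) (blockProd_le_one hδ V _)
      | succ c hc ih =>
        rw [blockProd_succ, blockProd_succ, ← mul_assoc]
        refine mul_le_mul ih ?_ (by split_ifs; exacts [(hδ c).1.le, zero_le_one]) (hp U c).le
        by_cases hU : c ∈ blockUnion U
        · have hV : c ∈ blockUnion V := by
            by_contra hV
            have : c ≤ M := hM ⟨hU, hV⟩
            omega
          simp [hU, hV]
        · simp only [hU, if_false]
          split_ifs
          exacts [(hδ c).2.le, le_rfl]
  refine ⟨(d ^ (M + 1))⁻¹, by positivity, fun c => ?_⟩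
  rw [inv_mul_eq_div, le_div_iff₀ (by positivity), mul_comm]
  exact key c

/-- On a block l in U \ V starting at a, the product for U falls by at least s^(la), while that for
V stays constant and is still at least d^a. -/
theorem exists_blockProd_le_eps_mul (hδ : ∀ m, δ m ∈ Set.Ioo (0 : ℝ) 1) (hd : 0 < d)
    (hdδ : ∀ m, d ≤ δ m) (hs : s < 1) (hsδ : ∀ m, δ m ≤ s) {U V : Set ℕ}
    (h : ¬ AlmostSubset U V) {ε : ℝ} (hε : 0 < ε) :
    ∃ c, blockProd δ U (c + 1) ≤ ε * blockProd δ V (c + 1) := by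
  classical
  have hs0 : 0 < s := (hδ 0).1.trans_le (hsδ 0)
  wlog hε1 : ε ≤ 1 generalizing ε
  · obtain ⟨c, hc⟩ := this one_pos le_rfl
    exact ⟨c, hc.trans (mul_le_mul_of_nonneg_right (le_of_not_ge hε1) (blockProd_pos hδ V _).le)⟩
  -- From s^l ≤ εd follows s^(la) ≤ ε^a d^a, and ε^a ≤ ε because a ≥ 1 and ε ≤ 1.
  obtain ⟨l0, hl0⟩ := exists_pow_lt_of_lt_one (mul_pos hε hd) hs
  obtain ⟨l, ⟨hlU, hlV⟩, hl⟩ := (show (U \ V).Infinite from h).exists_gt l0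
  set a := blockStart l with ha
  have ha1 : 1 ≤ a := by
    have := blockStart_strictMono (show 0 < l by omega)
    omega
  have hsl : s ^ l ≤ ε * d :=
    (pow_le_pow_of_le_one hs0.le hs.le hl.le).trans hl0.le
  have hUstep : ∀ i ≤ 1 + l * a, blockProd δ U (a + i) ≤ s ^ i := by
    intro i
    induction i with
    | zero => intro _; simpa using blockProd_le_one hδ U a
    | succ i ih =>
      intro hi
      have hm : a + i ∈ blockUnion U := ⟨l, hlU, by
        refine Set.mem_Ico.2 ⟨by omega, ?_⟩
        rw [blockStart_succ, ← ha]; omega⟩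
      rw [← add_assoc, blockProd_succ, if_pos hm, pow_succ]
      exact mul_le_mul (ih (by omega)) (hsδ _) (hδ _).1.le (by positivity)
  have hVstep : ∀ i ≤ 1 + l * a, blockProd δ V (a + i) = blockProd δ V a := by
    intro i
    induction i with
    | zero => intro _; rfl
    | succ i ih =>
      intro hi
      have hm : a + i ∉ blockUnion V := by
        rintro ⟨l', hl', hm⟩
        have : a + i ∈ block l := by
          refine Set.mem_Ico.2 ⟨by omega, ?_⟩
          rw [blockStart_succ, ← ha]; omega
        exact hlV (eq_of_mem_block this hm ▸ hl')
      rw [← add_assoc, blockProd_succ, if_neg hm, mul_one, ih (by omega)]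
  refine ⟨a + l * a, ?_⟩
  rw [show a + l * a + 1 = a + (1 + l * a) by ring, hVstep _ le_rfl]
  have h1 := pow_mul_blockProd_le hδ hd hdδ V 0 a
  rw [blockProd_zero, zero_add, mul_one] at h1
  calc blockProd δ U (a + (1 + l * a)) ≤ s ^ (1 + l * a) := hUstep _ le_rfl
    _ ≤ s ^ (l * a) := pow_le_pow_of_le_one hs0.le hs.le (by omega)
    _ = (s ^ l) ^ a := pow_mul _ _ _
    _ ≤ (ε * d) ^ a := by gcongr
    _ = ε ^ a * d ^ a := mul_pow _ _ _
    _ ≤ ε * blockProd δ V a := by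
      refine mul_le_mul ?_ h1 (by positivity) hε.le
      simpa using pow_le_pow_of_le_one hε.le hε1 ha1

end blockProd

section blockSeq

variable {δ : ℕ → ℝ} {k : ℕ → ℕ}

/-- The number c of the k m that are at most n does not depend on U, so statements about products
transfer to all the sequences simultaneously. -/
theorem exists_blockSeq_eq (hk : StrictMono k) (hk2 : ∀ m, 2 ≤ k m) (n : ℕ) :
    ∃ c, (∀ m, m < c ↔ k m ≤ n) ∧ ∀ U, blockSeq δ k U n = blockProd δ U c := by
  classical
  induction n with
  | zero => exact ⟨0, fun m => by have := hk2 m; omega, fun U => rfl⟩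
  | succ n ih =>
    obtain ⟨c, hc, hU⟩ := ih
    by_cases h : n + 1 = k c
    · refine ⟨c + 1, fun m => ?_, fun U => ?_⟩
      · rw [h, hk.le_iff_le]; omega
      · rw [blockProd_succ, ← hU]
        by_cases hm : c ∈ blockUnion U
        · obtain ⟨l, hl, hm'⟩ := hm
          rw [blockSeq_of_mem hk.injective h hl hm', if_pos ⟨l, hl, hm'⟩, mul_comm]
        · rw [if_neg hm, mul_one, blockSeq_of_not]
          rintro ⟨m, hm1, hm2⟩
          rw [hk.injective (hm1.symm.trans h)] at hm2
          exact hm hm2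
    · have hne : ∀ m, k m ≠ n + 1 := by
        intro m hm
        have h1 : ¬ m < c := by rw [hc]; omega
        have h2 : ¬ k c ≤ n := by rw [← hc]; omega
        have h3 : k c ≤ k m := hk.monotone (not_lt.1 h1)
        omega
      refine ⟨c, fun m => ?_, fun U => ?_⟩
      · rw [hc]; have := hne m; omega
      · rw [← hU, blockSeq_of_not]
        rintro ⟨m, hm1, -⟩
        exact hne m hm1.symm

theorem blockSeq_pos (hδ : ∀ m, δ m ∈ Set.Ioo (0 : ℝ) 1) (hk : StrictMono k)
    (hk2 : ∀ m, 2 ≤ k m) (U : Set ℕ) (n : ℕ) : 0 < blockSeq δ k U n := by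
  obtain ⟨c, -, h⟩ := exists_blockSeq_eq (δ := δ) hk hk2 n
  rw [h]
  exact blockProd_pos hδ U c

theorem exists_blockSeq_le_mul {d : ℝ} (hδ : ∀ m, δ m ∈ Set.Ioo (0 : ℝ) 1) (hd : 0 < d)
    (hdδ : ∀ m, d ≤ δ m) (hk : StrictMono k) (hk2 : ∀ m, 2 ≤ k m) {U V : Set ℕ}
    (h : AlmostSubset U V) :
    ∃ C, 0 < C ∧ ∀ n, blockSeq δ k V n ≤ C * blockSeq δ k U n := by
  obtain ⟨C, hC, h1⟩ := exists_blockProd_le_mul hδ hd hdδ h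
  refine ⟨C, hC, fun n => ?_⟩
  obtain ⟨c, -, h⟩ := exists_blockSeq_eq (δ := δ) hk hk2 n
  rw [h, h]
  exact h1 c

theorem exists_blockSeq_le_eps_mul {d s : ℝ} (hδ : ∀ m, δ m ∈ Set.Ioo (0 : ℝ) 1) (hd : 0 < d)
    (hdδ : ∀ m, d ≤ δ m) (hs : s < 1) (hsδ : ∀ m, δ m ≤ s) (hk : StrictMono k)
    (hk2 : ∀ m, 2 ≤ k m) {U V : Set ℕ} (h : ¬ AlmostSubset U V) {ε : ℝ} (hε : 0 < ε) :
    ∃ n, blockSeq δ k U n ≤ ε * blockSeq δ k V n := by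
  obtain ⟨c, hc⟩ := exists_blockProd_le_eps_mul hδ hd hdδ hs hsδ h hε
  obtain ⟨c', h1, h2⟩ := exists_blockSeq_eq (δ := δ) hk hk2 (k c)
  have : c' = c + 1 := by
    have e1 := (h1 c).2 le_rfl
    have e2 : ¬ c + 1 < c' := by rw [h1, hk.le_iff_le]; omega
    omega
  exact ⟨k c, by rw [h2, h2, this]; exact hc⟩

theorem sq_mul_blockSeq_le {d : ℝ} (hδ : ∀ m, δ m ∈ Set.Ioo (0 : ℝ) 1) (hd : 0 < d)
    (hdδ : ∀ m, d ≤ δ m) (hk : StrictMono k) (hk2 : ∀ m, 2 ≤ k m)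
    (hkd : ∀ m, 2 * k m ≤ k (m + 1)) (U : Set ℕ) (n : ℕ) :
    d ^ 2 * blockSeq δ k U n ≤ blockSeq δ k U (2 * n + 2) := by
  obtain ⟨c, h1, h2⟩ := exists_blockSeq_eq (δ := δ) hk hk2 n
  obtain ⟨c', h1', h2'⟩ := exists_blockSeq_eq (δ := δ) hk hk2 (2 * n + 2)
  -- Since k c ≥ n + 1, doubling twice gives k (c + 2) ≥ 4n + 4 > 2n + 2: at most two factors are
  -- acquired between n and 2n + 2.
  have hc : c' ≤ c + 2 := by
    have e1 : ¬ c < c := lt_irrefl _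
    rw [h1] at e1
    have e2 := hkd c
    have e3 := hkd (c + 1)
    have e4 : ¬ c + 2 < c' := by rw [h1']; change ¬ k (c + 1 + 1) ≤ _; omega
    omega
  rw [h2, h2']
  exact (pow_mul_blockProd_le hδ hd hdδ U c 2).trans (blockProd_antitone hδ U hc)

/-- The ratio `u_U / u_V` of two of the sequences, for `U ⊆ V`, is increasing with jumps bounded
below. -/
theorem blockSeq_div_succ {s : ℝ} (hδ : ∀ m, δ m ∈ Set.Ioo (0 : ℝ) 1) (hs : s < 1)
    (hsδ : ∀ m, δ m ≤ s) (hk : StrictMono k) (hk2 : ∀ m, 2 ≤ k m) {U V : Set ℕ} (h : U ⊆ V)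
    (n : ℕ) :
    blockSeq δ k U (n + 1) / blockSeq δ k V (n + 1) = blockSeq δ k U n / blockSeq δ k V n ∨
    (1 - s) * (blockSeq δ k U n / blockSeq δ k V n) ≤
      blockSeq δ k U (n + 1) / blockSeq δ k V (n + 1) - blockSeq δ k U n / blockSeq δ k V n := by
  have hpU := blockSeq_pos hδ hk hk2 U n
  have hpV := blockSeq_pos hδ hk hk2 V n
  by_cases hm : ∃ m, n + 1 = k m ∧ ∃ l ∈ V, m ∈ block l
  · obtain ⟨m, hm, l, hl, hml⟩ := hm
    have hδm := (hδ m).1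
    rw [blockSeq_of_mem hk.injective hm hl hml]
    by_cases hlU : l ∈ U
    · left
      rw [blockSeq_of_mem hk.injective hm hlU hml]
      field_simp
    · right
      rw [blockSeq_of_not]
      · have e : blockSeq δ k U n / (δ m * blockSeq δ k V n) =
            (1 / δ m) * (blockSeq δ k U n / blockSeq δ k V n) := by field_simp
        -- Holds because δ m ≤ s and s(2 - s) ≤ 1.
        have e2 : 1 + (1 - s) ≤ 1 / δ m := by
          rw [le_div_iff₀ hδm]; nlinarith [hsδ m]
        have e3 : 0 < blockSeq δ k U n / blockSeq δ k V n := by positivity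
        rw [e]
        nlinarith
      · rintro ⟨m', hm', l', hl', hml'⟩
        rw [hk.injective (hm'.symm.trans hm)] at hml'
        exact hlU (eq_of_mem_block hml' hml ▸ hl')
  · left
    rw [blockSeq_of_not hm, blockSeq_of_not]
    rintro ⟨m, h1, l, hl, h2⟩
    exact hm ⟨m, h1, l, h hl, h2⟩

end blockSeq

/-! ### Interpolation between dyadic points -/

theorem exists_dyadic_bounds {t : ℝ} (ht : 0 < t) (ht1 : t ≤ 1) :
    ∃ n : ℕ, (1 / 2 : ℝ) ^ (n + 1) < t ∧ t ≤ (1 / 2) ^ n :=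
  exists_nat_pow_near_of_lt_one ht ht1 (by norm_num) (by norm_num)

theorem coe_dyadicPt (n : ℕ) : (dyadicPt n : ℝ) = (1 / 2) ^ n := by
  simp [dyadicPt]

/-- If x lies in (2^(-(n+1)), 2^(-n)], then x² > 2^(-(2n+2)), so the condition on squares is
`sq_mul_blockSeq_le` with constant d². -/
theorem isSlowWeight_of_interp {δ : ℕ → ℝ} {k : ℕ → ℕ} {d : ℝ}
    (hδ : ∀ m, δ m ∈ Set.Ioo (0 : ℝ) 1) (hd : 0 < d) (hdδ : ∀ m, d ≤ δ m) (hk : StrictMono k)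
    (hk2 : ∀ m, 2 ≤ k m) (hkd : ∀ m, 2 * k m ≤ k (m + 1)) {U : Set ℕ} {ψ : I → ℝ≥0}
    (hc : Continuous ψ) (hm : Monotone ψ)
    (hi : ∀ n, (ψ (dyadicPt n) : ℝ) = blockSeq δ k U n) : IsSlowWeight ψ where
  cont := hc
  pos x hx := by
    obtain ⟨n, h1, -⟩ := exists_dyadic_bounds (t := x) hx x.2.2
    have h2 : ψ (dyadicPt (n + 1)) ≤ ψ x := hm (Subtype.coe_le_coe.1 (by
      rw [coe_dyadicPt]; exact h1.le))
    refine lt_of_lt_of_le (NNReal.coe_pos.1 ?_) h2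
    rw [hi]
    exact blockSeq_pos hδ hk hk2 U _
  ess := ⟨1, le_rfl, fun x y hxy => by rw [one_mul]; exact hm hxy⟩
  sq := by
    have hd1 : d ≤ 1 := (hdδ 0).trans (hδ 0).2.le
    refine ⟨⟨d ^ 2, by positivity⟩, NNReal.coe_pos.1 (show 0 < d ^ 2 by positivity), fun x => ?_⟩
    rcases eq_or_lt_of_le x.2.1 with hx | hx
    · have e : x ^ 2 = x := Subtype.ext (by simp [← hx])
      rw [e]
      exact mul_le_of_le_one_left' (NNReal.coe_le_coe.1 (pow_le_one₀ hd.le hd1))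
    · obtain ⟨n, h1, h2⟩ := exists_dyadic_bounds hx x.2.2
      have h3 : ψ (dyadicPt (2 * n + 2)) ≤ ψ (x ^ 2) := hm (Subtype.coe_le_coe.1 (by
        rw [coe_dyadicPt, show 2 * n + 2 = (n + 1) * 2 by ring, pow_mul]
        simpa using pow_le_pow_left₀ (by positivity) h1.le 2))
      have h4 : ψ x ≤ ψ (dyadicPt n) := hm (Subtype.coe_le_coe.1 (by rwa [coe_dyadicPt]))
      rw [← NNReal.coe_le_coe] at h3 h4 ⊢
      rw [hi] at h3 h4
      refine le_trans ?_ ((sq_mul_blockSeq_le hδ hd hdδ hk hk2 hkd U n).trans h3)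
      exact mul_le_mul_of_nonneg_left h4 (by positivity)

/-! ### Baire category: Borel maps on products of finite sets are almost diagonal -/

section Reducibility

open Filter Topology PiNat
open scoped ENNReal

section BlockDecomposition

variable {F : ℕ → Type*}

/-- The sequence that starts with `r` and continues with the terms of `y`. -/
def splice (k : ℕ) (r : ∀ j : Fin k, F j) (y : ∀ j, F j) (j : ℕ) : F j :=
  if h : j < k then r ⟨j, h⟩ else y j

theorem splice_of_lt {k : ℕ} (r : ∀ j : Fin k, F j) (y : ∀ j, F j) {j : ℕ} (h : j < k) :
    splice k r y j = r ⟨j, h⟩ := dif_pos h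

theorem splice_of_le {k : ℕ} (r : ∀ j : Fin k, F j) (y : ∀ j, F j) {j : ℕ} (h : k ≤ j) :
    splice k r y j = y j := dif_neg (not_lt.2 h)

theorem splice_restrict {k : ℕ} {w y : ∀ j, F j} (h : ∀ j, k ≤ j → w j = y j) :
    splice k (fun j => w j) y = w := by
  funext j
  rcases lt_or_ge j k with hj | hj
  · exact splice_of_lt _ _ hj
  · rw [splice_of_le _ _ hj, h j hj]

/-- A property of cylinders that passes to subcylinders and holds densely can be achieved
simultaneously after all prefixes of length `k`. -/
theorem exists_forall_splice [∀ j, Finite (F j)] {R : (∀ j, F j) → ℕ → Prop}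
    (hR : ∀ y m, R y m → ∀ y' ∈ cylinder y m, ∀ m', m ≤ m' → R y' m')
    (hd : ∀ x n, ∃ y ∈ cylinder x n, ∃ m, n ≤ m ∧ R y m) {k l : ℕ} (hkl : k ≤ l)
    (z : ∀ j, F j) :
    ∃ z' ∈ cylinder z l, ∃ l', l ≤ l' ∧ ∀ r : ∀ j : Fin k, F j, R (splice k r z') l' := by
  classical
  have := Fintype.ofFinite (∀ j : Fin k, F j)
  -- There are finitely many prefixes. They are treated one after another, each time extending only
  -- the common continuation; since R passes to subcylinders, earlier successes persist.
  suffices H : ∀ s : Finset (∀ j : Fin k, F j),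
      ∃ z' ∈ cylinder z l, ∃ l', l ≤ l' ∧ ∀ r ∈ s, R (splice k r z') l' by
    obtain ⟨z', hz', l', hl', h⟩ := H Finset.univ
    exact ⟨z', hz', l', hl', fun r => h r (Finset.mem_univ r)⟩
  intro s
  induction s using Finset.induction_on with
  | empty => exact ⟨z, self_mem_cylinder _ _, l, le_rfl, by simp⟩
  | insert r s _ ih =>
    obtain ⟨z₁, hz₁, l₁, hl₁, h₁⟩ := ih
    obtain ⟨y, hy, m, hm, hRy⟩ := hd (splice k r z₁) l₁
    have hz' : (fun j => if j < k then z₁ j else y j) ∈ cylinder z₁ l₁ := by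
      intro j hj
      by_cases hjk : j < k
      · simp [hjk]
      · simp only [hjk, if_false]
        rw [hy j hj, splice_of_le _ _ (not_lt.1 hjk)]
    refine ⟨fun j => if j < k then z₁ j else y j, fun j hj => ?_, m, hl₁.trans hm, ?_⟩
    · rw [hz' j (hj.trans_le hl₁), hz₁ j hj]
    · intro r' hr'
      rcases Finset.mem_insert.1 hr' with rfl | hr'
      · convert hRy using 1
        funext j
        rcases lt_or_ge j k with hj | hj
        · rw [splice_of_lt _ _ hj, hy j (by omega), splice_of_lt _ _ hj]
        · rw [splice_of_le _ _ hj, if_neg (not_lt.2 hj)]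
      · refine hR _ _ (h₁ r' hr') _ (fun j hj => ?_) _ hm
        rcases lt_or_ge j k with hjk | hjk
        · rw [splice_of_lt _ _ hjk, splice_of_lt _ _ hjk]
        · rw [splice_of_le _ _ hjk, splice_of_le _ _ hjk]; exact hz' j hj

variable [∀ j, TopologicalSpace (F j)]

/-- The set `A` contains almost all points of the cylinder of `y` of length `m`, in the sense of
Baire category. -/
def Forces (y : ∀ j, F j) (m : ℕ) (A : Set (∀ j, F j)) : Prop :=
  ∀ᶠ w in residual (∀ j, F j), w ∈ cylinder y m → w ∈ A

theorem Forces.mono {y : ∀ j, F j} {m : ℕ} {A : Set (∀ j, F j)} (h : Forces y m A)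
    {y' : ∀ j, F j} (hy : y' ∈ cylinder y m) {m' : ℕ} (hm : m ≤ m') : Forces y' m' A := by
  refine Eventually.mono h fun w hw hw' => hw fun i hi => ?_
  rw [hw' i (hi.trans_le hm), hy i hi]

theorem Forces.mono_set {y : ∀ j, F j} {m : ℕ} {A B : Set (∀ j, F j)} (h : Forces y m A)
    (hAB : A ⊆ B) : Forces y m B :=
  Eventually.mono h fun _ hw hw' => hAB (hw hw')

theorem continuous_splice (k : ℕ) (r : ∀ j : Fin k, F j) : Continuous (splice k r) := by
  refine continuous_pi fun j => ?_
  rcases lt_or_ge j k with hj | hj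
  · simp only [splice_of_lt _ _ hj]
    exact continuous_const
  · simp only [splice_of_le _ _ hj]
    exact continuous_apply j

theorem exists_cylinder_subset [∀ j, DiscreteTopology (F j)] {U : Set (∀ j, F j)} (hU : IsOpen U) {w : ∀ j, F j} (hw : w ∈ U)
    (n : ℕ) : ∃ m, n ≤ m ∧ cylinder w m ⊆ U := by
  obtain ⟨_, ⟨x, m, rfl⟩, h1, h2⟩ :=
    (isTopologicalBasis_cylinders F).exists_subset_of_mem_open hw hU
  refine ⟨max n m, le_max_left _ _, (cylinder_anti w (le_max_right n m)).trans ?_⟩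
  rwa [mem_cylinder_iff_eq.1 h1]

theorem exists_cylinder_subset_of_dense [∀ j, DiscreteTopology (F j)] {U : Set (∀ j, F j)} (hU : IsOpen U) (hd : Dense U)
    (x : ∀ j, F j) (n : ℕ) : ∃ y ∈ cylinder x n, ∃ m, n ≤ m ∧ cylinder y m ⊆ U := by
  obtain ⟨y, hy, hyU⟩ := hd.inter_open_nonempty _ (isOpen_cylinder F x n) ⟨x, self_mem_cylinder x n⟩
  exact ⟨y, hy, exists_cylinder_subset hU hyU n⟩

/-- Each A i has the Baire property, so it agrees off a meagre set with an open O i. A generic point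
of the cylinder lies in some O i, hence so does a whole subcylinder. -/
theorem exists_forces [∀ j, Finite (F j)] [∀ j, DiscreteTopology (F j)]
    [MeasurableSpace (∀ j, F j)] [BorelSpace (∀ j, F j)]
    {A : ℕ → Set (∀ j, F j)} (hA : ∀ i, MeasurableSet (A i)) (hcov : ∀ y, ∃ i, y ∈ A i)
    (x : ∀ j, F j) (n : ℕ) :
    ∃ y ∈ cylinder x n, ∃ m, n ≤ m ∧ ∃ i, Forces y m (A i) := by
  choose O hO hAO using fun i => (hA i).residualEq_isOpen
  have hev : ∀ᶠ w in residual (∀ j, F j), ∀ i, (w ∈ A i ↔ w ∈ O i) :=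
    eventually_countable_forall.2 fun i => (hAO i).mono fun w hw => iff_of_eq hw
  obtain ⟨w, hw, hwx⟩ := (dense_of_mem_residual hev).inter_open_nonempty _
    (isOpen_cylinder F x n) ⟨x, self_mem_cylinder x n⟩
  obtain ⟨i, hi⟩ := hcov w
  obtain ⟨m, hm, hsub⟩ := exists_cylinder_subset (hO i) ((hwx i).1 hi) n
  exact ⟨w, hw, m, hm, i, hev.mono fun v hv hvw => (hv i).2 (hsub hvw)⟩

/-- Forcing depends only on a finite prefix and there are countably many prefixes, so almost every
point satisfies all that its own prefixes force. -/
theorem exists_dense_open_seq_of_forces [∀ j, Finite (F j)] {ι : Type*} [Countable ι] (A : ι → Set (∀ j, F j)) :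
    ∃ D : ℕ → Set (∀ j, F j), (∀ n, IsOpen (D n)) ∧ (∀ n, Dense (D n)) ∧
      ∀ w, (∀ n, w ∈ D n) → ∀ i m, Forces w m (A i) → w ∈ A i := by
  have hev : ∀ᶠ w in residual (∀ j, F j), ∀ (i : ι) (m : ℕ) (r : ∀ j : Fin m, F j),
      (∀ᶠ v in residual (∀ j, F j), (∀ j : Fin m, v j = r j) → v ∈ A i) →
      (∀ j : Fin m, w j = r j) → w ∈ A i := by
    refine eventually_countable_forall.2 fun i => eventually_countable_forall.2 fun m =>
      eventually_countable_forall.2 fun r => ?_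
    by_cases h : ∀ᶠ v in residual (∀ j, F j), (∀ j : Fin m, v j = r j) → v ∈ A i
    · exact h.mono fun v hv _ => hv
    · exact Eventually.of_forall fun v hv => absurd hv h
  obtain ⟨S, hS, hSd, hSc, hsub⟩ := mem_residual_iff.1 hev
  -- Adding the whole space makes the family nonempty, so that ℕ enumerates it.
  obtain ⟨D, hD⟩ := (hSc.insert Set.univ).exists_eq_range ⟨_, Set.mem_insert _ _⟩
  have hmem : ∀ n, D n = Set.univ ∨ D n ∈ S := fun n => by
    have : D n ∈ insert Set.univ S := hD ▸ Set.mem_range_self n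
    simpa using this
  refine ⟨D, fun n => ?_, fun n => ?_, fun w hw i m hf => ?_⟩
  · rcases hmem n with h | h
    · rw [h]; exact isOpen_univ
    · exact hS _ h
  · rcases hmem n with h | h
    · rw [h]; exact dense_univ
    · exact hSd _ h
  · refine hsub (Set.mem_sInter.2 fun t ht => ?_) i m (fun j => w j) ?_ fun _ => rfl
    · obtain ⟨n, rfl⟩ : t ∈ Set.range D := hD ▸ Set.mem_insert_of_mem _ ht
      exact hw n
    · exact Eventually.mono hf fun v hv hv' => hv fun j hj => hv' ⟨j, hj⟩

end BlockDecomposition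

section HeadTail

variable {F : ℕ → Type*} {Y : Type*} {ρ : Y → Y → ℝ≥0∞} {θ : (∀ j, F j) → ℕ → Y}

/-- The points `y` such that changing `y` below `k` moves `θ y` by at most `ε` beyond `L`. -/
def tailSet (ρ : Y → Y → ℝ≥0∞) (θ : (∀ j, F j) → ℕ → Y) (k L : ℕ) (ε : ℝ≥0∞) :
    Set (∀ j, F j) :=
  {y | ∀ r r' : ∀ j : Fin k, F j,
    ∑' n, ρ (θ (splice k r y) (n + L)) (θ (splice k r' y) (n + L)) ≤ ε}

/-- The points `y` such that `θ y` is `ε`-close to `c` below `L`. -/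
def headSet (ρ : Y → Y → ℝ≥0∞) (θ : (∀ j, F j) → ℕ → Y) (L : ℕ) (ε : ℝ≥0∞) (c : ℕ → Y) :
    Set (∀ j, F j) :=
  {y | ∑ n ∈ Finset.range L, ρ (θ y n) (c n) ≤ ε}

theorem ENNReal.tsum_add_le_of_le (f : ℕ → ℝ≥0∞) {L L' : ℕ} (h : L ≤ L') :
    ∑' n, f (n + L') ≤ ∑' n, f (n + L) := by
  obtain ⟨d, rfl⟩ := Nat.exists_eq_add_of_le h
  rw [← ENNReal.summable.sum_add_tsum_nat_add' (f := fun n => f (n + L)) (k := d)]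
  refine le_add_left (le_of_eq ?_)
  congr 1
  funext n
  congr 1
  omega

theorem tailSet_mono (k : ℕ) {L L' : ℕ} (h : L ≤ L') (ε : ℝ≥0∞) :
    tailSet ρ θ k L ε ⊆ tailSet ρ θ k L' ε := fun _ hy r r' =>
  (ENNReal.tsum_add_le_of_le
    (fun n => ρ (θ (splice k r _) n) (θ (splice k r' _) n)) h).trans (hy r r')

end HeadTail

section BlockDecomposition

variable {F : ℕ → Type*} {Y : Type*} {ρ : Y → Y → ℝ≥0∞}
  {θ : (∀ j, F j) → ℕ → Y}

theorem measurableSet_tailSet [∀ j, TopologicalSpace (F j)] [∀ j, Finite (F j)]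
    [∀ j, DiscreteTopology (F j)]
    [∀ j, MeasurableSpace (F j)] [∀ j, BorelSpace (F j)] [TopologicalSpace Y] [SecondCountableTopology Y]
    [MeasurableSpace Y] [BorelSpace Y]
    (hρ : Continuous fun p : Y × Y => ρ p.1 p.2) (hθ : Measurable θ)
    (k L : ℕ) (ε : ℝ≥0∞) : MeasurableSet (tailSet ρ θ k L ε) := by
  simp only [tailSet, Set.ofPred_forall]
  refine MeasurableSet.iInter fun r => MeasurableSet.iInter fun r' => ?_
  refine measurableSet_le (Measurable.tsum fun n => ?_) measurable_const
  have h : ∀ r : ∀ j : Fin k, F j, Measurable fun y => θ (splice k r y) (n + L) := fun r =>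
    (measurable_pi_apply _).comp (hθ.comp (continuous_splice k r).measurable)
  exact hρ.measurable.comp ((h r).prodMk (h r'))

theorem measurableSet_headSet [∀ j, MeasurableSpace (F j)] [TopologicalSpace Y] [SecondCountableTopology Y]
    [MeasurableSpace Y] [BorelSpace Y] (hρ : Continuous fun p : Y × Y => ρ p.1 p.2) (hθ : Measurable θ)
    (L : ℕ) (ε : ℝ≥0∞) (c : ℕ → Y) : MeasurableSet (headSet ρ θ L ε c) := by
  refine measurableSet_le (Finset.measurable_sum _ fun n _ => ?_) measurable_const
  exact hρ.measurable.comp (((measurable_pi_apply n).comp hθ).prodMk measurable_const)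

/-- Tails of each finite sum tend to 0, and only finitely many pairs of prefixes have to be served.
-/
theorem exists_mem_tailSet [∀ j, Finite (F j)]
    (hfin : ∀ (x y : ∀ j, F j) (k : ℕ), (∀ j, k ≤ j → x j = y j) →
      ∑' n, ρ (θ x n) (θ y n) ≠ ∞)
    (k : ℕ) {ε : ℝ≥0∞} (hε : 0 < ε) (y : ∀ j, F j) : ∃ L, y ∈ tailSet ρ θ k L ε := by
  have h : ∀ p : (∀ j : Fin k, F j) × (∀ j : Fin k, F j), ∀ᶠ L in atTop,
      ∑' n, ρ (θ (splice k p.1 y) (n + L)) (θ (splice k p.2 y) (n + L)) ≤ ε := by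
    intro p
    have := hfin (splice k p.1 y) (splice k p.2 y) k fun j hj => by
      rw [splice_of_le _ _ hj, splice_of_le _ _ hj]
    exact (ENNReal.tendsto_sum_nat_add _ this).eventually_le_const hε
  obtain ⟨L, hL⟩ := (eventually_all.2 h).exists
  exact ⟨L, fun r r' => hL (r, r')⟩

theorem exists_mem_headSet [TopologicalSpace Y] [SecondCountableTopology Y]
    [Nonempty Y] (hρ : Continuous fun p : Y × Y => ρ p.1 p.2)
    (hρ0 : ∀ x, ρ x x = 0) (L : ℕ) {ε : ℝ≥0∞} (hε : 0 < ε) (y : ∀ j, F j) :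
    ∃ i, y ∈ headSet ρ θ L ε (TopologicalSpace.denseSeq (ℕ → Y) i) := by
  have hc : Continuous fun c : ℕ → Y => ∑ n ∈ Finset.range L, ρ (θ y n) (c n) :=
    continuous_finsetSum _ fun n _ =>
      hρ.comp (continuous_const.prodMk (continuous_apply n))
  obtain ⟨c, hc1, i, rfl⟩ := (TopologicalSpace.denseRange_denseSeq (ℕ → Y)).inter_open_nonempty
    {c | ∑ n ∈ Finset.range L, ρ (θ y n) (c n) < ε} (isOpen_lt hc continuous_const)
    ⟨θ y, by simpa [hρ0] using hε⟩
  exact ⟨i, (show _ < ε from hc1).le⟩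

/-- One step of the construction of the block decomposition. -/
theorem exists_window [∀ j, TopologicalSpace (F j)] [∀ j, Finite (F j)]
    [∀ j, DiscreteTopology (F j)]
    [∀ j, MeasurableSpace (F j)] [∀ j, BorelSpace (F j)] [TopologicalSpace Y] [SecondCountableTopology Y]
    [MeasurableSpace Y] [BorelSpace Y] [Nonempty Y] (hρ : Continuous fun p : Y × Y => ρ p.1 p.2)
    (hρ0 : ∀ x, ρ x x = 0) (hθ : Measurable θ)
    (hfin : ∀ (x y : ∀ j, F j) (k : ℕ), (∀ j, k ≤ j → x j = y j) →
      ∑' n, ρ (θ x n) (θ y n) ≠ ∞)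
    {G D : Set (∀ j, F j)} {ε : ℝ≥0∞} (hε : 0 < ε)
    (hGt : ∀ w ∈ G, ∀ k L m, Forces w m (tailSet ρ θ k L ε) → w ∈ tailSet ρ θ k L ε)
    (hGh : ∀ w ∈ G, ∀ L i m,
      Forces w m (headSet ρ θ L ε (TopologicalSpace.denseSeq (ℕ → Y) i)) →
      w ∈ headSet ρ θ L ε (TopologicalSpace.denseSeq (ℕ → Y) i))
    (hDo : IsOpen D) (hDd : Dense D) (z : ∀ j, F j) (k L₀ : ℕ) :
    ∃ z' ∈ cylinder z k, ∃ l L, k ≤ l ∧ L₀ < L ∧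
      (∀ w, (∀ m, k ≤ m → m < l → w m = z' m) → w ∈ D) ∧
      (∀ w ∈ G, (∀ m, k ≤ m → m < l → w m = z' m) → ∀ w', (∀ m, k ≤ m → w' m = w m) →
        ∑' n, ρ (θ w (n + L)) (θ w' (n + L)) ≤ ε) ∧
      (∀ w ∈ G, (∀ m, k ≤ m → m < l → w m = z' m) → ∃ c : ℕ → Y,
        ∀ w' ∈ G, (∀ m, m < l → w' m = w m) →
        ∑ n ∈ Finset.range L, ρ (θ w' n) (c n) ≤ ε) := by
  have hmem : ∀ {z' z : ∀ j, F j} {l : ℕ} {w : ∀ j, F j},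
      (∀ m, k ≤ m → m < l → w m = z' m) → w ∈ cylinder (splice k (fun j => w j) z') l := by
    intro z' z l w hw m hm
    rcases lt_or_ge m k with h | h
    · rw [splice_of_lt _ _ h]
    · rw [splice_of_le _ _ h, hw m h hm]
  obtain ⟨z₁, hz₁, l₁, hl₁, h₁⟩ := exists_forall_splice (R := fun y m => cylinder y m ⊆ D)
    (fun y m h y' hy' m' hm =>
      (cylinder_anti y' hm).trans ((mem_cylinder_iff_eq.1 hy').symm ▸ h))
    (exists_cylinder_subset_of_dense hDo hDd) (le_refl k) z
  obtain ⟨z₂, hz₂, l₂, hl₂, h₂⟩ := exists_forall_splice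
    (R := fun y m => ∃ L, Forces y m (tailSet ρ θ k L ε))
    (fun y m ⟨L, h⟩ y' hy' m' hm => ⟨L, h.mono hy' hm⟩)
    (fun x n => exists_forces (fun L => measurableSet_tailSet hρ hθ k L ε)
      (exists_mem_tailSet hfin k hε) x n) hl₁ z₁
  choose Lf hLf using h₂
  obtain ⟨L, hL⟩ := (Set.finite_range Lf).bddAbove
  -- One cutoff serves all the finitely many prefixes. It is fixed before the heads are treated,
  -- since the head sets depend on it.
  have hLf' : ∀ r, Forces (splice k r z₂) l₂ (tailSet ρ θ k (max L (L₀ + 1)) ε) := fun r =>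
    (hLf r).mono_set (tailSet_mono k ((hL ⟨r, rfl⟩).trans (le_max_left _ _)) ε)
  obtain ⟨z₃, hz₃, l₃, hl₃, h₃⟩ := exists_forall_splice
    (R := fun y m => ∃ i, Forces y m (headSet ρ θ (max L (L₀ + 1)) ε
      (TopologicalSpace.denseSeq (ℕ → Y) i)))
    (fun y m ⟨i, h⟩ y' hy' m' hm => ⟨i, h.mono hy' hm⟩)
    (fun x n => exists_forces (fun i => measurableSet_headSet hρ hθ _ ε _)
      (exists_mem_headSet hρ hρ0 _ hε) x n) (hl₁.trans hl₂) z₂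
  have hz₁₂ : ∀ m < l₁, z₂ m = z₁ m := hz₂
  have hz₂₃ : ∀ m < l₂, z₃ m = z₂ m := hz₃
  refine ⟨z₃, fun m hm => ?_, l₃, max L (L₀ + 1), by omega, by omega, ?_, ?_, ?_⟩
  · rw [hz₂₃ m (by omega), hz₁₂ m (by omega), hz₁ m hm]
  · intro w hw
    refine h₁ (fun j => w j) (hmem (z := z) fun m h1 h2 => ?_)
    rw [hw m h1 (by omega), hz₂₃ m (by omega), hz₁₂ m h2]
  · intro w hwG hw w' hw'
    have hwc : w ∈ cylinder (splice k (fun j => w j) z₂) l₂ :=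
      hmem (z := z) fun m h1 h2 => by rw [hw m h1 (by omega), hz₂₃ m h2]
    have := hGt w hwG k _ l₂ ((hLf' fun j => w j).mono hwc le_rfl) (fun j => w j) fun j => w' j
    rwa [splice_restrict (fun _ _ => rfl), splice_restrict hw'] at this
  · intro w hwG hw
    obtain ⟨i, hi⟩ := h₃ fun j => w j
    refine ⟨TopologicalSpace.denseSeq (ℕ → Y) i, fun w' hw'G hw' => ?_⟩
    have hwc : w' ∈ cylinder (splice k (fun j => w j) z₃) l₃ := by
      intro m hm
      rw [hw' m hm]
      exact hmem (z := z) hw m hm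
    exact hGh w' hw'G _ i l₃ (hi.mono hwc le_rfl)

end BlockDecomposition

/-- A symmetric function vanishing on the diagonal and satisfying the triangle inequality up to
the factor `c`. -/
structure IsQuasiDist {Y : Type*} (ρ : Y → Y → ℝ≥0∞) (c : ℝ≥0∞) : Prop where
  self : ∀ x, ρ x x = 0
  symm : ∀ x y, ρ x y = ρ y x
  triangle : ∀ x y z, ρ x z ≤ c * (ρ x y + ρ y z)
  ne_top : c ≠ ∞

theorem IsQuasiDist.tsum_triangle {Y : Type*} {ρ : Y → Y → ℝ≥0∞} {c : ℝ≥0∞}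
    (h : IsQuasiDist ρ c) {ι : Type*} (x y z : ι → Y) :
    ∑' n, ρ (x n) (z n) ≤ c * (∑' n, ρ (x n) (y n) + ∑' n, ρ (y n) (z n)) := by
  rw [← ENNReal.tsum_add, ← ENNReal.tsum_mul_left]
  exact ENNReal.tsum_le_tsum fun n => h.triangle _ _ _

theorem IsQuasiDist.tsum_triangle_ne_top {Y : Type*} {ρ : Y → Y → ℝ≥0∞} {c : ℝ≥0∞}
    (h : IsQuasiDist ρ c) {ι : Type*} {x y z : ι → Y} (h1 : ∑' n, ρ (x n) (y n) ≠ ∞)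
    (h2 : ∑' n, ρ (y n) (z n) ≠ ∞) : ∑' n, ρ (x n) (z n) ≠ ∞ :=
  ((h.tsum_triangle x y z).trans_lt
    (ENNReal.mul_lt_top h.ne_top.lt_top (ENNReal.add_lt_top.2 ⟨h1.lt_top, h2.lt_top⟩))).ne

/-- A strictly increasing sequence from `0` cuts `ℕ` into intervals. -/
theorem exists_interval_index {L : ℕ → ℕ} (hL : StrictMono L) (h0 : L 0 = 0) :
    ∃ β : ℕ → ℕ, ∀ n, L (β n) ≤ n ∧ n < L (β n + 1) := by
  refine ⟨fun n => Nat.findGreatest (fun i => L i ≤ n) n, fun n => ⟨?_, ?_⟩⟩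
  · exact Nat.findGreatest_spec (P := fun i => L i ≤ n) (Nat.zero_le n) (by simp [h0])
  · by_contra! h
    have h1 := Nat.le_findGreatest (P := fun i => L i ≤ n) ((hL.id_le _).trans h) h
    simp only [id] at h1
    omega

section BlockDecomposition

variable {F : ℕ → Type*} [∀ j, Finite (F j)] [∀ j, TopologicalSpace (F j)]
  [∀ j, DiscreteTopology (F j)] [∀ j, MeasurableSpace (F j)] [∀ j, BorelSpace (F j)]
  {Y : Type*} [TopologicalSpace Y] [SecondCountableTopology Y] [MeasurableSpace Y] [BorelSpace Y]
  {ρ : Y → Y → ℝ≥0∞} {θ : (∀ j, F j) → ℕ → Y} {c : ℝ≥0∞}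

/-- The coordinates `j i`, the base point `z` and the intervals `[L i, L (i + 1))` obtained by
iterating `exists_window`. -/
theorem exists_window_seq [∀ j, Nonempty (F j)] [Nonempty Y]
    (hρ : Continuous fun p : Y × Y => ρ p.1 p.2)
    (hρ0 : ∀ x, ρ x x = 0) (hθ : Measurable θ)
    (hfin : ∀ (x y : ∀ j, F j) (k : ℕ), (∀ j, k ≤ j → x j = y j) →
      ∑' n, ρ (θ x n) (θ y n) ≠ ∞)
    {ε : ℕ → ℝ≥0∞} (hε : ∀ i, 0 < ε i)
    {P : ℕ → ℕ → Prop} (hP : ∀ i k, ∃ j, k ≤ j ∧ P i j) :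
    ∃ (z : ∀ j, F j) (j L : ℕ → ℕ), StrictMono j ∧ StrictMono L ∧ L 0 = 0 ∧
      (∀ i, P i (j i)) ∧
      ∀ w, (∀ m, m ∉ Set.range j → w m = z m) → ∀ i,
        (∀ w', (∀ m, m ∉ Set.range j → w' m = z m) → (∀ m, j i < m → w' m = w m) →
          ∑' n, ρ (θ w (n + L (i + 1))) (θ w' (n + L (i + 1))) ≤ ε i) ∧
        ∃ e : ℕ → Y, ∀ w', (∀ m, m ∉ Set.range j → w' m = z m) →
          (∀ m, m ≤ j i → w' m = w m) →
          ∑ n ∈ Finset.range (L (i + 1)), ρ (θ w' n) (e n) ≤ ε i := by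
  obtain ⟨D, hDo, hDd, hD⟩ := exists_dense_open_seq_of_forces
    (ι := (ℕ × ℕ × ℕ) ⊕ (ℕ × ℕ × ℕ)) (F := F)
    (Sum.elim (fun p => tailSet ρ θ p.1 p.2.1 (ε p.2.2))
      (fun p => headSet ρ θ p.1 (ε p.2.2) (TopologicalSpace.denseSeq (ℕ → Y) p.2.1)))
  set G : Set (∀ j, F j) := {w | ∀ n, w ∈ D n} with hG
  -- A state consists of a base point, the length k below which it is final, and the current cutoff
  -- in the image. The free coordinate j precedes the new window [j + 1, k').
  have step : ∀ (i : ℕ) (s : (∀ j, F j) × ℕ × ℕ), ∃ (s' : (∀ j, F j) × ℕ × ℕ) (j : ℕ),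
      s'.1 ∈ cylinder s.1 s.2.1 ∧ s.2.1 ≤ j ∧ j < s'.2.1 ∧ s.2.2 < s'.2.2 ∧ P i j ∧
      (∀ w, (∀ m, j + 1 ≤ m → m < s'.2.1 → w m = s'.1 m) → w ∈ D i) ∧
      (∀ w ∈ G, (∀ m, j + 1 ≤ m → m < s'.2.1 → w m = s'.1 m) →
        ∀ w', (∀ m, j + 1 ≤ m → w' m = w m) →
        ∑' n, ρ (θ w (n + s'.2.2)) (θ w' (n + s'.2.2)) ≤ ε i) ∧
      (∀ w ∈ G, (∀ m, j + 1 ≤ m → m < s'.2.1 → w m = s'.1 m) → ∃ c : ℕ → Y,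
        ∀ w' ∈ G, (∀ m, m < s'.2.1 → w' m = w m) →
        ∑ n ∈ Finset.range s'.2.2, ρ (θ w' n) (c n) ≤ ε i) := by
    rintro i ⟨z, k, L₀⟩
    obtain ⟨j, hkj, hPj⟩ := hP i k
    obtain ⟨z', hz', l, L, hl, hL, h1, h2, h3⟩ := exists_window hρ hρ0 hθ hfin (hε i)
      (G := G) (D := D i) (fun w hw k L m => hD w hw (Sum.inl (k, L, i)) m)
      (fun w hw L i' m => hD w hw (Sum.inr (L, i', i)) m) (hDo i) (hDd i) z (j + 1) L₀
    exact ⟨(z', l, L), j, cylinder_anti z (Nat.le_succ_of_le hkj) hz', hkj, hl, hL, hPj, h1, h2, h3⟩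
  choose nxt jf hcyl hkj hjk hLL hPj h1 h2 h3 using step
  let s : ℕ → (∀ j, F j) × ℕ × ℕ :=
    fun i => Nat.rec (fun j => Classical.arbitrary (F j), 0, 0) (fun i s => nxt i s) i
  have hs : ∀ i, s (i + 1) = nxt i (s i) := fun i => rfl
  set j : ℕ → ℕ := fun i => jf i (s i) with hj
  have hkj' : ∀ i, (s i).2.1 ≤ j i := fun i => hkj i (s i)
  have hjk' : ∀ i, j i < (s (i + 1)).2.1 := fun i => hjk i (s i)
  have hkmono : StrictMono fun i => (s i).2.1 :=
    strictMono_nat_of_lt_succ fun i => (hkj' i).trans_lt (hjk' i)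
  have hjmono : StrictMono j :=
    strictMono_nat_of_lt_succ fun i => (hjk' i).trans_le (hkj' (i + 1))
  have hLmono : StrictMono fun i => (s i).2.2 :=
    strictMono_nat_of_lt_succ fun i => hLL i (s i)
  have hcyl' : ∀ i i', i ≤ i' → ∀ m < (s i).2.1, (s i').1 m = (s i).1 m := by
    intro i i' hii'
    induction i', hii' using Nat.le_induction with
    | base => intro m _; rfl
    | succ i' hi ih =>
      intro m hm
      rw [← ih m hm]
      exact hcyl i' (s i') m (hm.trans_le (hkmono.monotone hi))
  have hz : ∀ i, ∀ m < (s i).2.1, (s (m + 1)).1 m = (s i).1 m := by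
    intro i m hm
    rcases le_total i (m + 1) with h | h
    · exact hcyl' i (m + 1) h m hm
    · exact (hcyl' (m + 1) i h m (hkmono.id_le (m + 1))).symm
  refine ⟨fun m => (s (m + 1)).1 m, j, fun i => (s i).2.2, hjmono, hLmono, rfl,
    fun i => hPj i (s i), ?_⟩
  -- No free coordinate falls into a window, so every admissible w shows the prescribed pattern
  -- there; this forces it into each D i, hence into G.
  have hwin : ∀ w : (∀ j, F j), (∀ m, m ∉ Set.range j → w m = (s (m + 1)).1 m) → ∀ i m,
      j i + 1 ≤ m → m < (s (i + 1)).2.1 → w m = (s (i + 1)).1 m := by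
    intro w hw i m hm1 hm2
    rw [hw m, hz (i + 1) m hm2]
    rintro ⟨i', rfl⟩
    have e1 : i < i' := hjmono.lt_iff_lt.1 hm1
    have e2 := hjmono.monotone (Nat.succ_le_of_lt e1)
    have e3 := hkj' (i + 1)
    rw [Nat.succ_eq_add_one] at e2
    omega
  have hwG : ∀ w : (∀ j, F j), (∀ m, m ∉ Set.range j → w m = (s (m + 1)).1 m) → w ∈ G :=
    fun w hw i => h1 i (s i) w (hwin w hw i)
  intro w hw i
  refine ⟨fun w' hw' hww' => h2 i (s i) w (hwG w hw) (hwin w hw i) w' hww', ?_⟩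
  obtain ⟨e, he⟩ := h3 i (s i) w (hwG w hw) (hwin w hw i)
  refine ⟨e, fun w' hw' hww' => he w' (hwG w' hw') fun m hm => ?_⟩
  rcases le_or_gt m (j i) with h | h
  · exact hww' m h
  · rw [hwin w' hw' i m h hm, hwin w hw i m h hm]

/-- If finite changes of the argument move the Borel map `θ` by finite `ρ`-sums, then on a product
of infinitely many coordinates, the other ones being fixed, `θ` is up to finite `ρ`-sums a
direct sum of maps of one coordinate each. -/
theorem exists_block_decomposition [∀ j, Nonempty (F j)] [Nonempty Y]
    (hρ : Continuous fun p : Y × Y => ρ p.1 p.2)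
    (hρc : IsQuasiDist ρ c) (hθ : Measurable θ)
    (hfin : ∀ (x y : ∀ j, F j) (k : ℕ), (∀ j, k ≤ j → x j = y j) →
      ∑' n, ρ (θ x n) (θ y n) ≠ ∞)
    {P : ℕ → ℕ → Prop} (hP : ∀ i k, ∃ j, k ≤ j ∧ P i j) :
    ∃ (z : ∀ j, F j) (j β : ℕ → ℕ), StrictMono j ∧ (∀ i, P i (j i)) ∧
      ∀ w, (∀ m, m ∉ Set.range j → w m = z m) →
        ∑' n, ρ (θ w n) (θ (Function.update z (j (β n)) (w (j (β n)))) n) ≠ ∞ := by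
  obtain ⟨z, j, L, hj, hL, hL0, hPj, H⟩ := exists_window_seq hρ hρc.self hθ hfin
    (ε := fun i => 2⁻¹ ^ i) (fun i => ENNReal.pow_pos (by simp) i) hP
  obtain ⟨β, hβ⟩ := exists_interval_index hL hL0
  have hβi : ∀ {n i}, β n = i → L i ≤ n ∧ n < L (i + 1) := by rintro n i rfl; exact hβ n
  refine ⟨z, j, β, hj, hPj, fun w hw => ?_⟩
  have hsplit : ∑' n, ρ (θ w n) (θ (Function.update z (j (β n)) (w (j (β n)))) n) =
      ∑' i, ∑' n, if β n = i then ρ (θ w n) (θ (Function.update z (j i) (w (j i))) n) else 0 := by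
    rw [ENNReal.tsum_comm]
    refine tsum_congr fun n => ?_
    rw [tsum_eq_single (β n) fun i hi => if_neg hi.symm, if_pos rfl]
  -- the two ways in which `w` and the update of `z` are compared on the block `i`
  set v : ℕ → ∀ j, F j := fun i m => if m < j i then z m else w m with hv
  have hvX : ∀ i m, m ∉ Set.range j → v i m = z m := by
    intro i m hm
    simp only [hv]
    split_ifs
    exacts [rfl, hw m hm]
  have huX : ∀ i m, m ∉ Set.range j → Function.update z (j i) (w (j i)) m = z m := by
    intro i m hm
    exact Function.update_of_ne (fun h => hm ⟨i, h.symm⟩) _ _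
  -- For i > 0, `v i` differs from w only at coordinates up to j (i - 1), so the tail estimate of
  -- window i - 1 bounds this by 2^(-(i-1)); for i = 0 nothing is changed.
  have htail : ∀ i, ∑' n, (if β n = i then ρ (θ w n) (θ (v i) n) else 0) ≤ 2 * 2⁻¹ ^ i := by
    intro i
    rcases i with _ | i
    · have : v 0 = w := by
        funext m
        by_cases hm : m < j 0
        · simp only [hv, hm, if_true]
          refine (hw m ?_).symm
          rintro ⟨i, rfl⟩
          exact absurd (hj.lt_iff_lt.1 hm) (Nat.not_lt_zero _)
        · simp [hv, hm]
      simp [this, hρc.self]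
    · have h1 := (H w hw i).1 (v (i + 1)) (hvX _) fun m hm => by
        simp only [hv]
        split_ifs with h
        · refine (hw m ?_).symm
          rintro ⟨i', rfl⟩
          have e1 := hj.lt_iff_lt.1 hm
          have e2 := hj.lt_iff_lt.1 h
          omega
        · rfl
      calc _ ≤ ∑' n, ρ (θ w (n + L (i + 1))) (θ (v (i + 1)) (n + L (i + 1))) := by
            rw [← ENNReal.summable.sum_add_tsum_nat_add'
              (f := fun n => if β n = i + 1 then ρ (θ w n) (θ (v (i + 1)) n) else 0)
              (k := L (i + 1)), Finset.sum_eq_zero, zero_add]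
            · refine ENNReal.tsum_le_tsum fun n => ?_
              split_ifs
              exacts [le_rfl, zero_le]
            · intro n hn
              refine if_neg fun h => ?_
              have := (hβi h).1
              rw [Finset.mem_range] at hn
              omega
        _ ≤ 2⁻¹ ^ i := h1
        _ = 2 * 2⁻¹ ^ (i + 1) := by
            rw [pow_succ', ← mul_assoc, ENNReal.mul_inv_cancel (by simp) (by simp), one_mul]
  -- `v i` and the update of z agree up to j i, so below L (i + 1) both are 2^(-i)-close to the same
  -- e.
  have hhead : ∀ i, ∑' n, (if β n = i then
      ρ (θ (v i) n) (θ (Function.update z (j i) (w (j i))) n) else 0) ≤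
      c * (2⁻¹ ^ i + 2⁻¹ ^ i) := by
    intro i
    obtain ⟨e, he⟩ := (H (v i) (hvX i) i).2
    have h1 := he (v i) (hvX i) fun m _ => rfl
    have h2 := he (Function.update z (j i) (w (j i))) (huX i) fun m hm => by
      rcases hm.eq_or_lt with rfl | hm
      · simp [hv]
      · simp [hv, hm, hm.ne]
    rw [tsum_eq_sum (s := Finset.range (L (i + 1)))]
    · calc _ ≤ ∑ n ∈ Finset.range (L (i + 1)), c * (ρ (θ (v i) n) (e n) +
            ρ (θ (Function.update z (j i) (w (j i))) n) (e n)) := by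
            refine Finset.sum_le_sum fun n _ => ?_
            split_ifs
            · rw [hρc.symm _ (e n), hρc.symm _ (e n), hρc.symm (e n) (θ (v i) n)]
              exact hρc.triangle _ _ _
            · exact zero_le
        _ ≤ _ := by
            rw [← Finset.mul_sum, Finset.sum_add_distrib]
            gcongr
    · intro n hn
      refine if_neg fun h => hn (Finset.mem_range.2 (hβi h).2)
  have hblock : ∀ i, ∑' n, (if β n = i then
      ρ (θ w n) (θ (Function.update z (j i) (w (j i))) n) else 0) ≤
      (c * (2 + c * 2)) * 2⁻¹ ^ i := by
    intro i
    calc _ ≤ ∑' n, c * ((if β n = i then ρ (θ w n) (θ (v i) n) else 0) + (if β n = i then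
          ρ (θ (v i) n) (θ (Function.update z (j i) (w (j i))) n) else 0)) := by
          refine ENNReal.tsum_le_tsum fun n => ?_
          split_ifs
          · exact hρc.triangle _ _ _
          · simp
      _ ≤ c * (2 * 2⁻¹ ^ i + c * (2⁻¹ ^ i + 2⁻¹ ^ i)) := by
          rw [ENNReal.tsum_mul_left, ENNReal.tsum_add]
          gcongr
          exacts [htail i, hhead i]
      _ = _ := by ring
  rw [hsplit]
  refine ((ENNReal.tsum_le_tsum hblock).trans_lt ?_).ne
  rw [ENNReal.tsum_mul_left, ENNReal.tsum_geometric]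
  have hc := hρc.ne_top.lt_top
  refine ENNReal.mul_lt_top (ENNReal.mul_lt_top hc (ENNReal.add_lt_top.2
    ⟨by simp, ENNReal.mul_lt_top hc (by simp)⟩)) ?_
  simp

end BlockDecomposition

/-! ### The relations E_f and quasi-distances -/

section relE

variable {f g : I → ℝ≥0} {F G : ℝ → ℝ} {A : ℝ}

theorem unitDist_self (x : I) : unitDist x x = 0 := Subtype.ext (by simp [unitDist])

theorem unitDist_comm (x y : I) : unitDist x y = unitDist y x :=
  Subtype.ext (abs_sub_comm _ _)

theorem continuous_unitDist : Continuous fun p : I × I => unitDist p.1 p.2 :=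
  Continuous.subtype_mk (by fun_prop) _

theorem relE_iff {x y : ℕ → I} :
    relE f x y ↔ ∑' n, (f (unitDist (x n) (y n)) : ℝ≥0∞) ≠ ∞ :=
  ENNReal.tsum_coe_ne_top_iff_summable.symm

theorem IsGauge.isQuasiDist (hG : IsGauge G A) (hg : ∀ x : I, (g x : ℝ) = G x) :
    IsQuasiDist (fun x y : I => (g (unitDist x y) : ℝ≥0∞)) (A.toNNReal ^ 3 : ℝ≥0) where
  self x := by
    rw [unitDist_self, ENNReal.coe_eq_zero, ← NNReal.coe_eq_zero, hg]
    exact hG.zero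
  symm x y := by rw [unitDist_comm]
  triangle x y z := by
    rw [← ENNReal.coe_add, ← ENNReal.coe_mul, ENNReal.coe_le_coe, ← NNReal.coe_le_coe]
    push_cast
    rw [hg, hg, hg, Real.coe_toNNReal _ (zero_le_one.trans hG.one_le)]
    exact hG.abs_sub_le _ _ _
  ne_top := ENNReal.coe_ne_top

theorem IsQuasiDist.equivalence_relE {c : ℝ≥0∞}
    (h : IsQuasiDist (fun x y : I => (g (unitDist x y) : ℝ≥0∞)) c) : Equivalence (relE g) where
  refl x := relE_iff.2 (by simp [h.self])
  symm hxy := by simpa only [relE, unitDist_comm] using hxy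
  trans hxy hyz := relE_iff.2 (h.tsum_triangle_ne_top (relE_iff.1 hxy) (relE_iff.1 hyz))

theorem relE_of_le_mul {C : ℝ≥0} (h : ∀ x, f x ≤ C * g x) {x y : ℕ → I} (hxy : relE g x y) :
    relE f x y :=
  NNReal.summable_of_le (fun _ => h _) (hxy.mul_left C)

end relE

/-! ### Nonreducibility when f/g has lower limit 0 -/

/-- The point `a / K` of `[0,1]`, if `a ≤ K`. -/
noncomputable def gridPt (K a : ℕ) : I := Set.projIcc 0 1 zero_le_one ((a : ℝ) / K)

theorem coe_gridPt {K a : ℕ} (h : a ≤ K) : (gridPt K a : ℝ) = a / K := by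
  rw [gridPt, Set.coe_projIcc, min_eq_right, max_eq_right]
  · positivity
  · exact div_le_one_of_le₀ (by exact_mod_cast h) (by positivity)

theorem unitDist_gridPt_succ {N s : ℕ} (h : s < 2 ^ N) :
    unitDist (gridPt (2 ^ N) s) (gridPt (2 ^ N) (s + 1)) = dyadicPt N := by
  refine Subtype.ext ?_
  rw [coe_dyadicPt]
  simp only [unitDist]
  rw [coe_gridPt h.le, coe_gridPt h, ← sub_div]
  push_cast
  rw [add_sub_cancel_left, abs_of_pos (by positivity), one_div_pow]

theorem unitDist_gridPt_zero {K : ℕ} (h : 0 < K) : unitDist (gridPt K 0) (gridPt K K) = 1 := by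
  have : (K : ℝ) ≠ 0 := by positivity
  refine Subtype.ext ?_
  simp only [unitDist]
  rw [coe_gridPt (Nat.zero_le K), coe_gridPt le_rfl]
  simp [this]

/-- A reduction of `relE f` yields one of the direct sum of the finite grids of mesh `1 / κ i`
that is a direct sum of maps of one coordinate. -/
theorem exists_diagonal {f g : I → ℝ≥0} (hf0 : f 0 = 0) (hgc : Continuous g) {c : ℝ≥0∞}
    (hg : IsQuasiDist (fun x y : I => (g (unitDist x y) : ℝ≥0∞)) c)
    (hred : BorelReducible (relE f) (relE g)) (κ : ℕ → ℕ) :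
    ∃ p : ℕ → ℕ → ℕ → I, ∀ a b : ℕ → ℕ, (∀ i, a i ≤ κ i) → (∀ i, b i ≤ κ i) →
      (∑' i, (f (unitDist (gridPt (κ i) (a i)) (gridPt (κ i) (b i))) : ℝ≥0∞) ≠ ∞ ↔
        ∑' i, ∑' n, (g (unitDist (p i (a i) n) (p i (b i) n)) : ℝ≥0∞) ≠ ∞) := by
  obtain ⟨θ, hθ, hθE⟩ := hred
  -- Every grid size recurs infinitely often, so the increasing coordinates j i can be required to
  -- carry the grid of size κ i.
  set τ : ℕ → ℕ := fun j => κ (Nat.unpair j).1 with hτ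
  set ι : (∀ j, Fin (τ j + 1)) → ℕ → I := fun x j => gridPt (τ j) (x j) with hι
  have hιm : Measurable ι := measurable_pi_iff.2 fun j =>
    (Measurable.of_discrete (f := fun a : Fin (τ j + 1) => gridPt (τ j) a)).comp
      (measurable_pi_apply j)
  have hcont : Continuous fun p : I × I => (g (unitDist p.1 p.2) : ℝ≥0∞) :=
    ENNReal.continuous_coe.comp (hgc.comp continuous_unitDist)
  obtain ⟨z, j, β, hj, hPj, H⟩ := exists_block_decomposition
    (F := fun j => Fin (τ j + 1)) (θ := fun x => θ (ι x)) (P := fun i j => (Nat.unpair j).1 = i)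
    hcont hg (hθ.comp hιm) (fun x y k hxy => by
      refine relE_iff.1 ((hθE _ _).1 (relE_iff.2 ?_))
      rw [tsum_eq_sum (s := Finset.range k)]
      · exact ENNReal.sum_ne_top.2 fun _ _ => ENNReal.coe_ne_top
      · intro n hn
        rw [Finset.mem_range, not_lt] at hn
        simp only [hι]
        rw [hxy n hn, unitDist_self, hf0, ENNReal.coe_zero])
    (fun i k => ⟨Nat.pair i k, Nat.right_le_pair i k, by simp⟩)
  have hτj : ∀ i, τ (j i) = κ i := fun i => by simp only [hτ]; rw [hPj]
  set u : ℕ → ℕ → ∀ j, Fin (τ j + 1) := fun i a => Function.update z (j i) (Fin.ofNat _ a) with hu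
  -- p i is the i-th block of θ as a function of the i-th free coordinate. Outside this block it is
  -- 0 and contributes nothing.
  refine ⟨fun i a n => if β n = i then θ (ι (u i a)) n else 0, fun a b ha hb => ?_⟩
  have hw : ∀ a : ℕ → ℕ, ∃ w : ∀ j, Fin (τ j + 1), (∀ m, m ∉ Set.range j → w m = z m) ∧
      ∀ i, w (j i) = Fin.ofNat _ (a i) := by
    classical
    intro a
    refine ⟨fun m => if h : ∃ i, j i = m then Fin.ofNat _ (a h.choose) else z m,
      fun m hm => dif_neg hm, fun i => ?_⟩
    have h : ∃ i', j i' = j i := ⟨i, rfl⟩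
    simp only [dif_pos h]
    rw [hj.injective h.choose_spec]
  obtain ⟨v, hv, hva⟩ := hw a
  obtain ⟨w, hw, hwb⟩ := hw b
  have hval : ∀ (x : ∀ j, Fin (τ j + 1)) (a : ℕ → ℕ), (∀ i, a i ≤ κ i) →
      (∀ i, x (j i) = Fin.ofNat _ (a i)) → ∀ i, ι x (j i) = gridPt (κ i) (a i) := by
    intro x a ha hx i
    simp only [hι]
    rw [hx, Fin.val_ofNat, hτj, Nat.mod_eq_of_lt (Nat.lt_succ_of_le (ha i))]
  have hleft : ∑' i, (f (unitDist (gridPt (κ i) (a i)) (gridPt (κ i) (b i))) : ℝ≥0∞) =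
      ∑' m, (f (unitDist (ι v m) (ι w m)) : ℝ≥0∞) := by
    rw [← hj.injective.tsum_eq (f := fun m => (f (unitDist (ι v m) (ι w m)) : ℝ≥0∞))]
    · refine tsum_congr fun i => ?_
      rw [hval v a ha hva, hval w b hb hwb]
    · intro m hm
      by_contra hmj
      refine hm ?_
      simp only [hι]
      rw [hv m hmj, hw m hmj, unitDist_self, hf0, ENNReal.coe_zero]
  have hright : ∑' i, ∑' n, (g (unitDist (if β n = i then θ (ι (u i (a i))) n else 0)
      (if β n = i then θ (ι (u i (b i))) n else 0)) : ℝ≥0∞) =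
      ∑' n, (g (unitDist (θ (ι (Function.update z (j (β n)) (v (j (β n))))) n)
        (θ (ι (Function.update z (j (β n)) (w (j (β n))))) n)) : ℝ≥0∞) := by
    rw [ENNReal.tsum_comm]
    refine tsum_congr fun n => ?_
    rw [tsum_eq_single (β n)]
    · rw [if_pos rfl, if_pos rfl, hva, hwb]
    · intro i hi
      rw [if_neg hi.symm, if_neg hi.symm]
      exact hg.self 0
  rw [hleft, hright, ← relE_iff, hθE, relE_iff]
  have Hv := H v hv
  have Hw := H w hw
  have Hv' := Hv
  have Hw' := Hw
  simp only [hg.symm (θ (ι v) _)] at Hv'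
  simp only [hg.symm (θ (ι w) _)] at Hw'
  constructor
  · intro h
    exact hg.tsum_triangle_ne_top (hg.tsum_triangle_ne_top Hv' h) Hw
  · intro h
    exact hg.tsum_triangle_ne_top (hg.tsum_triangle_ne_top Hv h) Hw'

/-- Repeating each m exactly ⌈1/γ m⌉ times makes its share of the γ-sum at least 1 and its share of
the φ-sum at most (1 + γ m) 2^(-m). -/
theorem exists_seq_tsum_ne_top_and_eq_top {φ γ : ℕ → ℝ≥0} {B : ℝ≥0} (hγ : ∀ m, 0 < γ m)
    (hB : ∀ m, γ m ≤ B) (h : ∀ m, φ m ≤ 2⁻¹ ^ m * γ m) :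
    ∃ t : ℕ → ℕ, ∑' i, (φ (t i) : ℝ≥0∞) ≠ ∞ ∧ ∑' i, (γ (t i) : ℝ≥0∞) = ∞ := by
  set M : ℕ → ℕ := fun m => ⌈(γ m)⁻¹⌉₊ with hM
  have hM0 : ∀ m, 0 < M m := fun m => Nat.ceil_pos.2 (inv_pos.2 (hγ m))
  have : Infinite (Σ m, Fin (M m)) :=
    Infinite.of_injective (fun m => (⟨m, ⟨0, hM0 m⟩⟩ : Σ m, Fin (M m)))
      fun m m' h => congrArg Sigma.fst h
  have := Denumerable.ofEncodableOfInfinite (Σ m, Fin (M m))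
  let e : ℕ ≃ Σ m, Fin (M m) := (Denumerable.eqv _).symm
  have key : ∀ η : ℕ → ℝ≥0, ∑' i, (η (e i).1 : ℝ≥0∞) = ∑' m, ((M m * η m : ℝ≥0) : ℝ≥0∞) := by
    intro η
    rw [e.tsum_eq fun p : Σ m, Fin (M m) => (η p.1 : ℝ≥0∞), ENNReal.tsum_sigma']
    refine tsum_congr fun m => ?_
    simp [tsum_fintype]
  refine ⟨fun i => (e i).1, ?_, ?_⟩
  · rw [key, ENNReal.tsum_coe_ne_top_iff_summable]
    refine NNReal.summable_of_le (g := fun m => M m * φ m) (f := fun m => (1 + B) * 2⁻¹ ^ m)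
      (fun m => ?_) ((NNReal.summable_geometric (by
        rw [← NNReal.coe_lt_coe]; norm_num)).mul_left _)
    have h1 : (M m : ℝ≥0) ≤ (γ m)⁻¹ + 1 := (Nat.ceil_lt_add_one (by positivity)).le
    calc M m * φ m ≤ ((γ m)⁻¹ + 1) * (2⁻¹ ^ m * γ m) := mul_le_mul' h1 (h m)
      _ = (1 + γ m) * 2⁻¹ ^ m := by
        have := (hγ m).ne'
        field_simp
      _ ≤ _ := by gcongr; exact hB m
  · rw [key]
    refine top_le_iff.1 ?_
    calc (∞ : ℝ≥0∞) = ∑' _ : ℕ, (1 : ℝ≥0∞) :=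
          (ENNReal.tsum_const_eq_top_of_ne_zero one_ne_zero).symm
      _ ≤ _ := ENNReal.tsum_le_tsum fun m => by
        rw [ENNReal.one_le_coe_iff]
        calc 1 = (γ m)⁻¹ * γ m := (inv_mul_cancel₀ (hγ m).ne').symm
          _ ≤ _ := by gcongr; exact Nat.le_ceil _

/-- Among the steps of a chain one is comparatively large. -/
theorem IsGauge.exists_step {g : I → ℝ≥0} {G : ℝ → ℝ} {A : ℝ} (hG : IsGauge G A)
    (hg : ∀ x : I, (g x : ℝ) = G x) (N : ℕ) (p : ℕ → ℕ → I) :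
    ∃ s < 2 ^ N, (g (dyadicPt N) : ℝ≥0∞) * ∑' n, (g (unitDist (p 0 n) (p (2 ^ N) n)) : ℝ≥0∞) ≤
      (A.toNNReal ^ 2 : ℝ≥0) * ∑' n, (g (unitDist (p s n) (p (s + 1) n)) : ℝ≥0∞) := by
  have hA : 0 ≤ A := zero_le_one.trans hG.one_le
  -- The step of largest total g-size is at least the average one; `chain_le`, summed over the
  -- coordinates n, bounds the average from below.
  obtain ⟨s, hs, hmax⟩ := (Finset.range (2 ^ N)).exists_max_image
    (fun s => ∑' n, (g (unitDist (p s n) (p (s + 1) n)) : ℝ≥0∞)) ⟨0, by simp⟩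
  refine ⟨s, Finset.mem_range.1 hs, ?_⟩
  have hchain : ∀ n, ((2 ^ N : ℕ) : ℝ≥0∞) * (g (dyadicPt N) *
      g (unitDist (p 0 n) (p (2 ^ N) n))) ≤ (A.toNNReal ^ 2 : ℝ≥0) *
      ∑ s ∈ Finset.range (2 ^ N), (g (unitDist (p s n) (p (s + 1) n)) : ℝ≥0∞) := by
    intro n
    have h := hG.chain_le (K := 2 ^ N) (by positivity) (fun s => (p s n : ℝ))
      (unitDist (p 0 n) (p (2 ^ N) n)).2.2
    rw [← ENNReal.coe_natCast, ← ENNReal.coe_mul, ← ENNReal.coe_mul, ← ENNReal.ofNNReal_finsetSum,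
      ← ENNReal.coe_mul, ENNReal.coe_le_coe, ← NNReal.coe_le_coe]
    push_cast
    simp only [hg, Real.coe_toNNReal _ hA]
    rw [coe_dyadicPt, one_div_pow, mul_comm (G _)]
    push_cast at h
    exact h
  have hsum := ENNReal.tsum_le_tsum hchain
  rw [ENNReal.tsum_mul_left, ENNReal.tsum_mul_left, ENNReal.tsum_mul_left,
    Summable.tsum_finsetSum fun _ _ => ENNReal.summable] at hsum
  have h2 : ∑ s ∈ Finset.range (2 ^ N), ∑' n, (g (unitDist (p s n) (p (s + 1) n)) : ℝ≥0∞) ≤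
      ((2 ^ N : ℕ) : ℝ≥0∞) * ∑' n, (g (unitDist (p s n) (p (s + 1) n)) : ℝ≥0∞) := by
    simpa using Finset.sum_le_card_nsmul _ _ _ hmax
  have h3 := hsum.trans (mul_le_mul_right h2 _)
  rw [mul_left_comm ((A.toNNReal ^ 2 : ℝ≥0) : ℝ≥0∞)] at h3
  exact (ENNReal.mul_le_mul_iff_right (Nat.cast_ne_zero.2 (by positivity)) (ENNReal.natCast_ne_top _)).1 h3

/-- A reduction in diagonal form must keep endpoints of almost all grids apart, and then cannot make
all single steps small enough. -/
theorem not_borelReducible_of_liminf {f g : I → ℝ≥0} {G : ℝ → ℝ} {A : ℝ} (hf0 : f 0 = 0)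
    (hf1 : 0 < f 1) (hgc : Continuous g) (hG : IsGauge G A) (hg : ∀ x : I, (g x : ℝ) = G x)
    (hfg : ∀ ε : ℝ≥0, 0 < ε → ∃ n, f (dyadicPt n) ≤ ε * g (dyadicPt n)) :
    ¬ BorelReducible (relE f) (relE g) := by
  intro hred
  choose N hN using fun m : ℕ => hfg (2⁻¹ ^ m) (by positivity)
  have hgpos : ∀ n, 0 < g (dyadicPt n) := fun n => by
    rw [← NNReal.coe_pos, hg]
    exact hG.pos _ (by rw [coe_dyadicPt]; positivity)
  have hgle : ∀ x, g x ≤ A.toNNReal * g 1 := fun x => by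
    rw [← NNReal.coe_le_coe]
    push_cast
    rw [hg, hg, Real.coe_toNNReal _ (zero_le_one.trans hG.one_le)]
    exact hG.mono _ _ x.2.1 x.2.2
  obtain ⟨t, ht1, ht2⟩ := exists_seq_tsum_ne_top_and_eq_top (fun m => hgpos (N m))
    (fun m => hgle _) hN
  have hQ := hG.isQuasiDist hg
  obtain ⟨p, hp⟩ := exists_diagonal hf0 hgc hQ hred fun i => 2 ^ N (t i)
  by_cases hcase : ∀ ε : ℝ≥0∞, 0 < ε →
      ∃ᶠ i in atTop, ∑' n, (g (unitDist (p i 0 n) (p i (2 ^ N (t i)) n)) : ℝ≥0∞) ≤ ε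
  -- Endpoint images are 2^(-m)-close along a subsequence: moving from 0 to 1 on these grids costs
  -- f(1) each time, but the g-sum of the images converges.
  · obtain ⟨ξ, hξ, hξD⟩ := extraction_forall_of_frequently fun m =>
      hcase (2⁻¹ ^ m) (ENNReal.pow_pos (by simp) m)
    classical
    have h := (hp (fun _ => 0) (fun i => if i ∈ Set.range ξ then 2 ^ N (t i) else 0)
      (fun _ => Nat.zero_le _) (fun i => by split_ifs <;> simp)).2 ?_
    · refine h (top_le_iff.1 ?_)
      calc (∞ : ℝ≥0∞) = ∑' _ : ℕ, (f 1 : ℝ≥0∞) :=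
            (ENNReal.tsum_const_eq_top_of_ne_zero (ENNReal.coe_ne_zero.2 hf1.ne')).symm
        _ = ∑' m, (f (unitDist (gridPt (2 ^ N (t (ξ m))) 0) (gridPt (2 ^ N (t (ξ m)))
              (if ξ m ∈ Set.range ξ then 2 ^ N (t (ξ m)) else 0))) : ℝ≥0∞) := by
            refine tsum_congr fun m => ?_
            rw [if_pos (Set.mem_range_self m), unitDist_gridPt_zero (by positivity)]
        _ ≤ _ := ENNReal.tsum_comp_le_tsum_of_injective hξ.injective
            fun i => (f (unitDist (gridPt (2 ^ N (t i)) 0) (gridPt (2 ^ N (t i))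
              (if i ∈ Set.range ξ then 2 ^ N (t i) else 0))) : ℝ≥0∞)
    · rw [← hξ.injective.tsum_eq]
      · refine ((ENNReal.tsum_le_tsum (g := fun m => 2⁻¹ ^ m) fun m => ?_).trans_lt ?_).ne
        · simpa using hξD m
        · rw [ENNReal.tsum_geometric]; simp
      · intro i hi
        by_contra hiξ
        exact hi (by simp [hiξ, unitDist_self, show g 0 = 0 by
          simpa [unitDist_self] using hQ.self 0])
  · push Not at hcase
    obtain ⟨ε, hε, hev⟩ := hcase
    rw [eventually_atTop] at hev
    obtain ⟨i₀, hi₀⟩ := hev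
    -- From i₀ on the endpoint images are more than ε apart. Moving along the large steps costs ∑
    -- f(2^(-N)) < ∞, while the images move by at least a constant times the divergent ∑ g(2^(-N)).
    choose s hs hstep using fun i => hG.exists_step hg (N (t i)) (p i)
    have h := (hp (fun i => if i₀ ≤ i then s i else 0) (fun i => if i₀ ≤ i then s i + 1 else 0)
      (fun i => by split_ifs; exacts [(hs i).le, Nat.zero_le _])
      (fun i => by split_ifs; exacts [hs i, Nat.zero_le _])).1 ?_
    · refine h (top_le_iff.1 ?_)
      set a : ℝ≥0∞ := ((A.toNNReal ^ 2 : ℝ≥0) : ℝ≥0∞) with ha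
      have ha0 : a ≠ 0 := by
        rw [ha, ENNReal.coe_ne_zero]
        exact pow_ne_zero _ (Real.toNNReal_pos.2 (zero_lt_one.trans_le hG.one_le)).ne'
      have htail : ∑' i, (g (dyadicPt (N (t (i + i₀)))) : ℝ≥0∞) = ∞ := by
        rw [← ENNReal.summable.sum_add_tsum_nat_add'
          (f := fun i => (g (dyadicPt (N (t i))) : ℝ≥0∞)) (k := i₀), ENNReal.add_eq_top] at ht2
        exact ht2.resolve_left (ENNReal.sum_ne_top.2 fun _ _ => ENNReal.coe_ne_top)
      calc (∞ : ℝ≥0∞) = a⁻¹ * ε * ∑' i, (g (dyadicPt (N (t (i + i₀)))) : ℝ≥0∞) := by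
            rw [htail, ENNReal.mul_top]
            exact mul_ne_zero (ENNReal.inv_ne_zero.2 ENNReal.coe_ne_top) hε.ne'
        _ ≤ ∑' i, ∑' n, (g (unitDist (p (i + i₀) (if i₀ ≤ i + i₀ then s (i + i₀) else 0) n)
              (p (i + i₀) (if i₀ ≤ i + i₀ then s (i + i₀) + 1 else 0) n)) : ℝ≥0∞) := by
            rw [← ENNReal.tsum_mul_left]
            refine ENNReal.tsum_le_tsum fun i => ?_
            rw [if_pos (Nat.le_add_left _ _), if_pos (Nat.le_add_left _ _), mul_assoc,
              ENNReal.inv_mul_le_iff ha0 ENNReal.coe_ne_top, mul_comm ε]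
            refine le_trans ?_ (hstep (i + i₀))
            gcongr
            exact (hi₀ _ (Nat.le_add_left _ _)).le
        _ ≤ _ := ENNReal.tsum_comp_le_tsum_of_injective (add_left_injective i₀)
            fun i => ∑' n, (g (unitDist (p i (if i₀ ≤ i then s i else 0) n)
              (p i (if i₀ ≤ i then s i + 1 else 0) n)) : ℝ≥0∞)
    · refine ne_top_of_le_ne_top ht1 (ENNReal.tsum_le_tsum fun i => ?_)
      split_ifs
      · rw [unitDist_gridPt_succ (hs i)]
      · rw [unitDist_self, hf0]; simp

/-! ### Weights for the reduction: rounding the increments of w -/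

/-- This is `jensen` for one summand a and K - 1 zeros; it makes the tail over fine scales
geometric. -/
theorem IsGauge.div_le {F : ℝ → ℝ} {A : ℝ} (h : IsGauge F A) {a : ℝ} (ha : 0 ≤ a) {K : ℕ}
    (hK : 0 < K) : F (a / K) ≤ A * F a / K := by
  have hK' : (0 : ℝ) < K := by exact_mod_cast hK
  have := h.jensen (K := K) (a := a / K) (by positivity) (fun i => if i = 0 then a else 0)
    (fun i => by split_ifs <;> simp [ha]) (by
      rw [Finset.sum_ite_eq' (Finset.range K) 0 fun _ => a, if_pos (Finset.mem_range.2 hK)]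
      exact (mul_div_cancel₀ a hK'.ne').le)
  rw [Finset.sum_eq_single_of_mem 0 (Finset.mem_range.2 hK)
    fun i _ hi => by rw [if_neg hi, h.zero], if_pos rfl] at this
  rw [le_div_iff₀ hK', mul_comm]
  exact this

section Ratio

variable {w : ℕ → ℝ} {d : ℝ}

theorem one_le_of_ratio (hw0 : w 0 = 1) (hd : 0 < d)
    (hw : ∀ n, w (n + 1) = w n ∨ d * w n ≤ w (n + 1) - w n) (n : ℕ) : 1 ≤ w n := by
  induction n with
  | zero => exact hw0.ge
  | succ n ih =>
    rcases hw n with h | h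
    · rw [h]; exact ih
    · have : 0 ≤ d * w n := by positivity
      linarith

/-- The increments of `w`, rounded up to integers. -/
noncomputable def ratioMult (w : ℕ → ℝ) : ℕ → ℕ
  | 0 => 1
  | n + 1 => ⌈w (n + 1) - w n⌉₊

theorem le_sum_ratioMult (hw0 : w 0 = 1) (n : ℕ) :
    w n ≤ ∑ m ∈ Finset.range (n + 1), (ratioMult w m : ℝ) := by
  induction n with
  | zero => simp [hw0, ratioMult]
  | succ n ih =>
    rw [Finset.sum_range_succ]
    have := Nat.le_ceil (w (n + 1) - w n)
    change w (n + 1) ≤ _ + (⌈w (n + 1) - w n⌉₊ : ℝ)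
    linarith

/-- A nonzero increment is at least d · w n ≥ d, so rounding it up multiplies it by at most 1 + 1/d.
-/
theorem sum_ratioMult_le (hw0 : w 0 = 1) (hd : 0 < d)
    (hw : ∀ n, w (n + 1) = w n ∨ d * w n ≤ w (n + 1) - w n) (n : ℕ) :
    ∑ m ∈ Finset.range (n + 1), (ratioMult w m : ℝ) ≤ (1 + d⁻¹) * w n := by
  have hd' : 0 < d⁻¹ := inv_pos.2 hd
  induction n with
  | zero => simp [hw0, ratioMult, hd.le]
  | succ n ih =>
    rw [Finset.sum_range_succ]
    have h1 : (ratioMult w (n + 1) : ℝ) ≤ (1 + d⁻¹) * (w (n + 1) - w n) := by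
      rcases hw n with h | h
      · simp [ratioMult, h]
      · have h2 := one_le_of_ratio hw0 hd hw n
        have h3 : 1 ≤ d⁻¹ * (w (n + 1) - w n) := by
          calc 1 = d⁻¹ * (d * 1) := by field_simp
            _ ≤ d⁻¹ * (w (n + 1) - w n) := by
              gcongr
              exact le_trans (by gcongr) h
        have h4 := Nat.ceil_lt_add_one (a := w (n + 1) - w n) (le_trans (by positivity) h)
        simp only [ratioMult]
        linarith
    linarith

variable {F G : ℝ → ℝ} {A : ℝ}

/-- With t ≈ 2^(-N), the scales n ≤ N contribute about w(N) G(t) ≈ F(t). For n > N each term is at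
most a constant times w(n) G(2^(-n)) = F(2^(-n)), which decays geometrically by `IsGauge.div_le`. -/
theorem exists_tsum_ratioMult_le (hF : IsGauge F A) (hG : IsGauge G A) (hw0 : w 0 = 1)
    (hd : 0 < d) (hw : ∀ n, w (n + 1) = w n ∨ d * w n ≤ w (n + 1) - w n)
    (hFG : ∀ n : ℕ, F ((1 / 2) ^ n) = w n * G ((1 / 2) ^ n)) :
    ∃ C : ℝ≥0∞, C ≠ ∞ ∧ ∀ t, 0 < t → t ≤ 1 → ∀ a : ℕ → ℝ, (∀ n, 0 ≤ a n) →
      (∀ n, a n ≤ 2 * A * G t) → (∀ n, a n ≤ 2 * A * G ((1 / 2) ^ n)) →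
      ∑' n, ENNReal.ofReal (ratioMult w n * a n) ≤ C * ENNReal.ofReal (F t) := by
  have hA := hF.one_le
  set B := 1 + d⁻¹ with hB
  have hB0 : 0 < B := by positivity
  have hw1 := one_le_of_ratio hw0 hd hw
  refine ⟨ENNReal.ofReal (2 * A ^ 4 * B) + ENNReal.ofReal (2 * A ^ 4 * B) * (1 - 2⁻¹)⁻¹,
    ?_, fun t ht ht1 a ha ha1 ha2 => ?_⟩
  · refine ENNReal.add_ne_top.2 ⟨ENNReal.ofReal_ne_top, ENNReal.mul_ne_top ENNReal.ofReal_ne_top ?_⟩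
    simp
  obtain ⟨N, hN1, hN2⟩ := exists_dyadic_bounds ht ht1
  have hFN : F ((1 / 2) ^ N) ≤ A ^ 2 * F t := by
    have e1 := hF.double ((1 / 2) ^ (N + 1)) (by positivity)
    rw [pow_succ', ← mul_assoc, show (2 : ℝ) * (1 / 2) = 1 by norm_num, one_mul, ← pow_succ'] at e1
    have e2 := hF.mono _ _ (by positivity) hN1.le
    calc _ ≤ _ := e1
      _ ≤ A * (A * F t) := by gcongr
      _ = _ := by ring
  have hGt := hG.nonneg ht.le
  rw [← ENNReal.summable.sum_add_tsum_nat_add'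
    (f := fun n => ENNReal.ofReal (ratioMult w n * a n)) (k := N + 1), add_mul]
  refine add_le_add ?_ ?_
  · rw [← ENNReal.ofReal_sum_of_nonneg fun n _ => mul_nonneg (Nat.cast_nonneg _) (ha n),
      ← ENNReal.ofReal_mul (by positivity)]
    refine ENNReal.ofReal_le_ofReal ?_
    calc ∑ n ∈ Finset.range (N + 1), (ratioMult w n : ℝ) * a n
        ≤ ∑ n ∈ Finset.range (N + 1), (ratioMult w n : ℝ) * (2 * A * G t) := by
          gcongr with n _; exact ha1 n
      _ = (∑ n ∈ Finset.range (N + 1), (ratioMult w n : ℝ)) * (2 * A * G t) := by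
          rw [Finset.sum_mul]
      _ ≤ (B * w N) * (2 * A * (A * G ((1 / 2) ^ N))) := by
          have := hw1 N
          gcongr
          · exact sum_ratioMult_le hw0 hd hw N
          · exact hG.mono _ _ ht.le hN2
      _ = 2 * A ^ 2 * B * F ((1 / 2) ^ N) := by rw [hFG]; ring
      _ ≤ 2 * A ^ 2 * B * (A ^ 2 * F t) := by gcongr
      _ = _ := by ring
  · have hterm : ∀ i, ENNReal.ofReal (ratioMult w (i + (N + 1)) * a (i + (N + 1))) ≤
        ENNReal.ofReal (2 * A ^ 4 * B) * ENNReal.ofReal (F t) * 2⁻¹ ^ i := by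
      intro i
      have e0 : (2⁻¹ : ℝ≥0∞) ^ i = ENNReal.ofReal ((1 / 2) ^ i) := by
        rw [ENNReal.ofReal_pow (by norm_num), one_div, ENNReal.ofReal_inv_of_pos (by norm_num)]
        simp
      rw [e0, ← ENNReal.ofReal_mul (by positivity),
        ← ENNReal.ofReal_mul (mul_nonneg (by positivity) (hF.nonneg ht.le))]
      refine ENNReal.ofReal_le_ofReal ?_
      set n := i + (N + 1) with hn
      have e1 : (ratioMult w n : ℝ) ≤ B * w n :=
        (Finset.single_le_sum (f := fun m => (ratioMult w m : ℝ)) (fun _ _ => Nat.cast_nonneg _)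
          (Finset.self_mem_range_succ n)).trans (sum_ratioMult_le hw0 hd hw n)
      have e2 : F ((1 / 2) ^ n) ≤ A * F ((1 / 2) ^ N) * (1 / 2) ^ i := by
        have := hF.div_le (a := (1 / 2) ^ N) (by positivity) (K := 2 ^ (i + 1)) (by positivity)
        have e3 : ((1 / 2 : ℝ) ^ N) / (2 ^ (i + 1) : ℕ) = (1 / 2) ^ n := by
          rw [hn, show i + (N + 1) = N + (i + 1) by ring, pow_add _ N]
          push_cast
          rw [div_eq_mul_one_div _ ((2 : ℝ) ^ (i + 1)), one_div_pow 2 (i + 1)]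
        rw [e3] at this
        refine this.trans ?_
        have hp : 0 ≤ A * F ((1 / 2) ^ N) :=
          mul_nonneg (by positivity) (hF.nonneg (by positivity))
        rw [div_eq_mul_one_div]
        refine mul_le_mul_of_nonneg_left ?_ hp
        push_cast
        rw [← one_div_pow]
        exact pow_le_pow_of_le_one (by norm_num) (by norm_num) (Nat.le_succ i)
      have hGn := hG.nonneg (t := (1 / 2) ^ n) (by positivity)
      have := hw1 n
      calc (ratioMult w n : ℝ) * a n ≤ (B * w n) * (2 * A * G ((1 / 2) ^ n)) := by
            exact mul_le_mul e1 (ha2 n) (ha n) (by positivity)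
        _ = 2 * A * B * F ((1 / 2) ^ n) := by rw [hFG]; ring
        _ ≤ 2 * A * B * (A * F ((1 / 2) ^ N) * (1 / 2) ^ i) := by gcongr
        _ ≤ 2 * A * B * (A * (A ^ 2 * F t) * (1 / 2) ^ i) := by gcongr
        _ = _ := by ring
    refine (ENNReal.tsum_le_tsum hterm).trans (le_of_eq ?_)
    rw [ENNReal.tsum_mul_left, ENNReal.tsum_geometric]
    ring

/-- The scales n ≤ N alone suffice. The power A^7 collects one use of monotonicity, two factors for
passing from 2^(-N) to t, three for the halvings from t to t/8, and one from the hypothesis on a. -/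
theorem exists_le_tsum_ratioMult (hF : IsGauge F A) (hG : IsGauge G A) (hw0 : w 0 = 1)
    (hd : 0 < d) (hw : ∀ n, w (n + 1) = w n ∨ d * w n ≤ w (n + 1) - w n)
    (hFG : ∀ n : ℕ, F ((1 / 2) ^ n) = w n * G ((1 / 2) ^ n)) :
    ∃ C : ℝ≥0∞, C ≠ ∞ ∧ ∀ t, 0 < t → t ≤ 1 → ∀ a : ℕ → ℝ, (∀ n, 0 ≤ a n) →
      (∀ n, t ≤ (1 / 2) ^ n → G (t / 8) ≤ A * a n) →
      ENNReal.ofReal (F t) ≤ C * ∑' n, ENNReal.ofReal (ratioMult w n * a n) := by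
  have hA := hF.one_le
  have hw1 := one_le_of_ratio hw0 hd hw
  refine ⟨ENNReal.ofReal (A ^ 7), ENNReal.ofReal_ne_top, fun t ht ht1 a ha ha1 => ?_⟩
  obtain ⟨N, hN1, hN2⟩ := exists_dyadic_bounds ht ht1
  have hwN := hw1 N
  have h8 : G t ≤ A ^ 3 * G (t / 8) := by
    have e1 := hG.double (t / 2) (by positivity)
    have e2 := hG.double (t / 4) (by positivity)
    have e3 := hG.double (t / 8) (by positivity)
    rw [show 2 * (t / 2) = t by ring] at e1
    rw [show 2 * (t / 4) = t / 2 by ring] at e2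
    rw [show 2 * (t / 8) = t / 4 by ring] at e3
    calc G t ≤ A * G (t / 2) := e1
      _ ≤ A * (A * G (t / 4)) := by gcongr
      _ ≤ A * (A * (A * G (t / 8))) := by gcongr
      _ = _ := by ring
  have hGN : G ((1 / 2) ^ N) ≤ A ^ 2 * G t := by
    have e1 := hG.double ((1 / 2) ^ (N + 1)) (by positivity)
    rw [pow_succ', ← mul_assoc, show (2 : ℝ) * (1 / 2) = 1 by norm_num, one_mul, ← pow_succ'] at e1
    have e2 := hG.mono _ _ (by positivity) hN1.le
    calc _ ≤ _ := e1
      _ ≤ A * (A * G t) := by gcongr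
      _ = _ := by ring
  have hG8 := hG.nonneg (t := t / 8) (by positivity)
  have hmain : F t ≤ A ^ 7 * ∑ n ∈ Finset.range (N + 1), (ratioMult w n : ℝ) * a n := by
    calc F t ≤ A * F ((1 / 2) ^ N) := hF.mono _ _ ht.le hN2
      _ = A * (w N * G ((1 / 2) ^ N)) := by rw [hFG]
      _ ≤ A * (w N * (A ^ 2 * (A ^ 3 * G (t / 8)))) := by gcongr; exact hGN.trans (by gcongr)
      _ = A ^ 6 * (w N * G (t / 8)) := by ring
      _ ≤ A ^ 6 * ((∑ n ∈ Finset.range (N + 1), (ratioMult w n : ℝ)) * G (t / 8)) := by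
          gcongr; exact le_sum_ratioMult hw0 N
      _ ≤ A ^ 6 * ∑ n ∈ Finset.range (N + 1), (ratioMult w n : ℝ) * (A * a n) := by
          rw [Finset.sum_mul]
          gcongr with n hn
          refine ha1 n (hN2.trans ?_)
          exact pow_le_pow_of_le_one (by norm_num) (by norm_num)
            (Nat.lt_succ_iff.1 (Finset.mem_range.1 hn))
      _ = _ := by
          rw [Finset.mul_sum, Finset.mul_sum]
          exact Finset.sum_congr rfl fun n _ => by ring
  calc ENNReal.ofReal (F t) ≤ _ := ENNReal.ofReal_le_ofReal hmain
    _ = ENNReal.ofReal (A ^ 7) *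
        ∑ n ∈ Finset.range (N + 1), ENNReal.ofReal (ratioMult w n * a n) := by
      rw [ENNReal.ofReal_mul (by positivity),
        ENNReal.ofReal_sum_of_nonneg fun n _ => mul_nonneg (Nat.cast_nonneg _) (ha n)]
    _ ≤ _ := by
      gcongr
      exact ENNReal.sum_le_tsum _

end Ratio

/-! ### Waves: maps resolving distances at one scale -/

section TrigWave

/-- The functions `2⁻ⁿ (1 + cos (2ⁿ x)) / 2` and `2⁻ⁿ (1 + sin (2ⁿ x)) / 2`. -/
noncomputable def trigWave (n : ℕ) (b : Bool) (x : I) : I :=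
  ⟨(1 / 2) ^ n * ((1 + cond b (Real.sin (2 ^ n * x)) (Real.cos (2 ^ n * x))) / 2), by
    have h : -1 ≤ cond b (Real.sin (2 ^ n * x)) (Real.cos (2 ^ n * x)) := by
      cases b
      exacts [Real.neg_one_le_cos _, Real.neg_one_le_sin _]
    have h' : cond b (Real.sin (2 ^ n * x)) (Real.cos (2 ^ n * x)) ≤ 1 := by
      cases b
      exacts [Real.cos_le_one _, Real.sin_le_one _]
    exact ⟨mul_nonneg (by positivity) (by linarith),
      mul_le_one₀ (pow_le_one₀ (by norm_num) (by norm_num)) (by linarith) (by linarith)⟩⟩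

theorem continuous_trigWave (n : ℕ) (b : Bool) : Continuous (trigWave n b) := by
  refine Continuous.subtype_mk ?_ _
  cases b <;> simp only [cond_true, cond_false] <;> fun_prop

theorem coe_unitDist_trigWave_le_pow (n : ℕ) (b : Bool) (x y : I) :
    (unitDist (trigWave n b x) (trigWave n b y) : ℝ) ≤ (1 / 2) ^ n := by
  have key : ∀ x : I, 0 ≤ (trigWave n b x : ℝ) ∧ (trigWave n b x : ℝ) ≤ (1 / 2) ^ n := by
    intro x
    refine ⟨(trigWave n b x).2.1, ?_⟩
    have h' : cond b (Real.sin (2 ^ n * x)) (Real.cos (2 ^ n * x)) ≤ 1 := by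
      cases b
      exacts [Real.cos_le_one _, Real.sin_le_one _]
    exact mul_le_of_le_one_right (by positivity) (by linarith)
  obtain ⟨h1, h2⟩ := key x
  obtain ⟨h3, h4⟩ := key y
  exact abs_sub_le_iff.2 ⟨by linarith, by linarith⟩

theorem coe_unitDist_trigWave (n : ℕ) (b : Bool) (x y : I) :
    (unitDist (trigWave n b x) (trigWave n b y) : ℝ) = (1 / 2) ^ n / 2 *
      |cond b (Real.sin (2 ^ n * y)) (Real.cos (2 ^ n * y)) -
        cond b (Real.sin (2 ^ n * x)) (Real.cos (2 ^ n * x))| := by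
  rw [← abs_of_pos (show (0 : ℝ) < (1 / 2) ^ n / 2 by positivity), ← abs_mul]
  simp only [unitDist, trigWave]
  congr 1
  ring

theorem coe_unitDist_trigWave_le (n : ℕ) (b : Bool) (x y : I) :
    (unitDist (trigWave n b x) (trigWave n b y) : ℝ) ≤ |(y : ℝ) - x| := by
  have h : |cond b (Real.sin (2 ^ n * y)) (Real.cos (2 ^ n * y)) -
        cond b (Real.sin (2 ^ n * x)) (Real.cos (2 ^ n * x))| ≤ 2 ^ n * |(y : ℝ) - x| := by
    rw [← abs_of_pos (show (0 : ℝ) < 2 ^ n by positivity), ← abs_mul, mul_sub,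
      abs_of_pos (show (0 : ℝ) < 2 ^ n by positivity)]
    cases b
    exacts [Real.abs_cos_sub_cos_le _ _, Real.abs_sin_sub_sin_le _ _]
  rw [coe_unitDist_trigWave]
  calc _ ≤ (1 / 2 : ℝ) ^ n / 2 * (2 ^ n * |(y : ℝ) - x|) := by gcongr
    _ = |(y : ℝ) - x| / 2 := by rw [one_div_pow]; field_simp
    _ ≤ _ := by linarith [abs_nonneg ((y : ℝ) - x)]

/-- With u = 2^n (y - x), the squared differences of sine and cosine add up to 2 - 2 cos u ≥ u²/8
for |u| ≤ 1, so one of the differences is at least |u|/4. -/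
theorem exists_le_coe_unitDist_trigWave {n : ℕ} {x y : I}
    (h : |(y : ℝ) - x| ≤ (1 / 2) ^ n) :
    ∃ b, |(y : ℝ) - x| / 8 ≤ unitDist (trigWave n b x) (trigWave n b y) := by
  set u : ℝ := 2 ^ n * y - 2 ^ n * x with hu
  have habs : |u| = 2 ^ n * |(y : ℝ) - x| := by
    rw [hu, ← mul_sub, abs_mul, abs_of_pos (show (0 : ℝ) < 2 ^ n by positivity)]
  have hu1 : |u| ≤ 1 := by
    rw [habs]
    calc _ ≤ (2 : ℝ) ^ n * (1 / 2) ^ n := by gcongr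
      _ = 1 := by rw [← mul_pow]; norm_num
  have hcos : Real.cos u ≤ 1 - u ^ 2 / 16 := by
    have h1 := Real.cos_le_one_sub_mul_cos_sq (hu1.trans (by linarith [Real.pi_gt_three]))
    have h2 : (1 : ℝ) / 16 ≤ 2 / Real.pi ^ 2 := by
      rw [div_le_div_iff₀ (by norm_num) (by positivity)]
      nlinarith [Real.pi_le_four, Real.pi_pos]
    nlinarith [sq_nonneg u]
  rw [hu, Real.cos_sub] at hcos
  rw [← hu] at hcos
  set s := Real.sin (2 ^ n * y) - Real.sin (2 ^ n * x) with hs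
  set c := Real.cos (2 ^ n * y) - Real.cos (2 ^ n * x) with hc
  have hsum : u ^ 2 / 8 ≤ s ^ 2 + c ^ 2 := by
    have e1 := Real.sin_sq_add_cos_sq (2 ^ n * (y : ℝ))
    have e2 := Real.sin_sq_add_cos_sq (2 ^ n * (x : ℝ))
    rw [hs, hc]
    nlinarith
  have hor : |u| / 4 ≤ |s| ∨ |u| / 4 ≤ |c| := by
    by_contra! hlt
    have e1 : s ^ 2 < u ^ 2 / 16 := by
      rw [← sq_abs s, ← sq_abs u]; nlinarith [abs_nonneg s, abs_nonneg u]
    have e2 : c ^ 2 < u ^ 2 / 16 := by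
      rw [← sq_abs c, ← sq_abs u]; nlinarith [abs_nonneg c, abs_nonneg u]
    linarith
  have hfin : ∀ v : ℝ, |u| / 4 ≤ v → |(y : ℝ) - x| / 8 ≤ (1 / 2) ^ n / 2 * v := by
    intro v hv
    calc |(y : ℝ) - x| / 8 = (1 / 2) ^ n / 2 * (|u| / 4) := by
          rw [habs, one_div_pow]; field_simp; ring
      _ ≤ _ := by gcongr
  rcases hor with h | h
  · exact ⟨true, by rw [coe_unitDist_trigWave]; exact hfin _ h⟩
  · exact ⟨false, by rw [coe_unitDist_trigWave]; exact hfin _ h⟩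

end TrigWave

theorem borelReducible_of_tsum {f g : I → ℝ≥0} {J : Type} [Encodable J] [Nonempty J] (T : J → I → I)
    (hT : ∀ q, Continuous (T q)) {C : ℝ≥0∞} (hC : C ≠ ∞)
    (h1 : ∀ x y, ∑' q, (g (unitDist (T q x) (T q y)) : ℝ≥0∞) ≤ C * f (unitDist x y))
    (h2 : ∀ x y, (f (unitDist x y) : ℝ≥0∞) ≤ C * ∑' q, (g (unitDist (T q x) (T q y)) : ℝ≥0∞)) :
    BorelReducible (relE f) (relE g) := by
  have := Denumerable.ofEncodableOfInfinite (ℕ × J)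
  let e : ℕ ≃ ℕ × J := (Denumerable.eqv _).symm
  refine ⟨fun x m => T (e m).2 (x (e m).1), measurable_pi_iff.2 fun m =>
    (hT _).measurable.comp (measurable_pi_apply _), fun x y => ?_⟩
  rw [relE_iff, relE_iff, e.tsum_eq fun p : ℕ × J =>
    (g (unitDist (T p.2 (x p.1)) (T p.2 (y p.1))) : ℝ≥0∞), ENNReal.tsum_prod']
  constructor
  · intro h
    refine ne_top_of_le_ne_top (ENNReal.mul_ne_top hC h) ?_
    rw [← ENNReal.tsum_mul_left]
    exact ENNReal.tsum_le_tsum fun i => h1 _ _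
  · intro h
    refine ne_top_of_le_ne_top (ENNReal.mul_ne_top hC h) ?_
    rw [← ENNReal.tsum_mul_left]
    exact ENNReal.tsum_le_tsum fun i => h2 _ _

/-- If `f = w g` at the dyadic points, with `w` increasing towards `0` and with jumps bounded
below, then `relE f` reduces to `relE g`. -/
theorem borelReducible_of_ratio {f g : I → ℝ≥0} {F G : ℝ → ℝ} {A d : ℝ} {w : ℕ → ℝ}
    (hF : IsGauge F A) (hf : ∀ x : I, (f x : ℝ) = F x)
    (hG : IsGauge G A) (hg : ∀ x : I, (g x : ℝ) = G x)
    (hw0 : w 0 = 1) (hd : 0 < d) (hw : ∀ n, w (n + 1) = w n ∨ d * w n ≤ w (n + 1) - w n)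
    (hFG : ∀ n : ℕ, F ((1 / 2) ^ n) = w n * G ((1 / 2) ^ n)) :
    BorelReducible (relE f) (relE g) := by
  obtain ⟨C₁, hC₁, h1⟩ := exists_tsum_ratioMult_le hF hG hw0 hd hw hFG
  obtain ⟨C₂, hC₂, h2⟩ := exists_le_tsum_ratioMult hF hG hw0 hd hw hFG
  have hf0 : f 0 = 0 := NNReal.coe_eq_zero.1 (by rw [hf]; exact hF.zero)
  have hg0 : g 0 = 0 := NNReal.coe_eq_zero.1 (by rw [hg]; exact hG.zero)
  -- The first `ratioMult w n` indices at scale n carry copies of the wave; the remaining ones carry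
  -- a constant map and contribute g(0) = 0.
  set T : ℕ × ℕ × Bool → I → I := fun q x =>
    if q.2.1 < ratioMult w q.1 then trigWave q.1 q.2.2 x else 0 with hT
  set a : I → I → ℕ → ℝ := fun x y n =>
    g (unitDist (trigWave n true x) (trigWave n true y)) +
    g (unitDist (trigWave n false x) (trigWave n false y)) with ha
  have hsum : ∀ x y, ∑' q, (g (unitDist (T q x) (T q y)) : ℝ≥0∞) =
      ∑' n, ENNReal.ofReal (ratioMult w n * a x y n) := by
    intro x y
    rw [ENNReal.tsum_prod']
    refine tsum_congr fun n => ?_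
    rw [ENNReal.tsum_prod', tsum_eq_sum (s := Finset.range (ratioMult w n))]
    · rw [Finset.sum_congr rfl (g := fun _ => ENNReal.ofReal (a x y n)), Finset.sum_const,
        Finset.card_range, nsmul_eq_mul, ENNReal.ofReal_mul (Nat.cast_nonneg _),
        ENNReal.ofReal_natCast]
      intro q hq
      rw [tsum_fintype, Fintype.sum_bool]
      simp only [hT, if_pos (Finset.mem_range.1 hq), ha]
      rw [ENNReal.ofReal_add (NNReal.coe_nonneg _) (NNReal.coe_nonneg _),
        ENNReal.ofReal_coe_nnreal, ENNReal.ofReal_coe_nnreal]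
    · intro q hq
      simp only [hT, if_neg (fun h => hq (Finset.mem_range.2 h)), unitDist_self, hg0]
      simp
  have ha0 : ∀ x y n, 0 ≤ a x y n := fun x y n => by positivity
  have hfx : ∀ x y : I, (f (unitDist x y) : ℝ≥0∞) = ENNReal.ofReal (F |(y : ℝ) - x|) := by
    intro x y
    rw [← ENNReal.ofReal_coe_nnreal, hf]
    rfl
  have hle1 : ∀ x y : I, |(y : ℝ) - x| ≤ 1 := fun x y => (unitDist x y).2.2
  refine borelReducible_of_tsum T (fun q => ?_) (ENNReal.add_ne_top.2 ⟨hC₁, hC₂⟩)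
    (fun x y => ?_) (fun x y => ?_)
  · by_cases h : q.2.1 < ratioMult w q.1
    · simp only [hT, if_pos h]; exact continuous_trigWave _ _
    · simp only [hT, if_neg h]; exact continuous_const
  · rcases eq_or_ne x y with rfl | hxy
    · simp [unitDist_self, hg0]
    · rw [hsum, hfx]
      refine (h1 _ (abs_pos.2 (sub_ne_zero.2 fun h => hxy (Subtype.ext h.symm))) (hle1 x y) _
        (ha0 x y) (fun n => ?_) fun n => ?_).trans (by gcongr; exact le_self_add)
      · have := fun b => hG.mono _ _ (unitDist (trigWave n b x) (trigWave n b y)).2.1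
          (coe_unitDist_trigWave_le n b x y)
        simp only [ha, hg]
        linarith [this true, this false]
      · have := fun b => hG.mono _ _ (unitDist (trigWave n b x) (trigWave n b y)).2.1
          (coe_unitDist_trigWave_le_pow n b x y)
        simp only [ha, hg]
        linarith [this true, this false]
  · rcases eq_or_ne x y with rfl | hxy
    · simp [unitDist_self, hf0]
    · rw [hsum, hfx]
      refine (h2 _ (abs_pos.2 (sub_ne_zero.2 fun h => hxy (Subtype.ext h.symm))) (hle1 x y) _
        (ha0 x y) fun n hn => ?_).trans (by gcongr; exact le_add_self)
      obtain ⟨b, hb⟩ := exists_le_coe_unitDist_trigWave hn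
      refine (hG.mono _ _ (by positivity) hb).trans ?_
      rw [← hg]
      refine mul_le_mul_of_nonneg_left ?_ (zero_le_one.trans hG.one_le)
      cases b
      exacts [le_add_of_nonneg_left (NNReal.coe_nonneg _),
        le_add_of_nonneg_right (NNReal.coe_nonneg _)]

end Reducibility

/-! ### Assembling the theorem -/

theorem IsSlowWeight.exists_isGauge_powMul {φ ψ : I → ℝ≥0} (hφ : IsSlowWeight φ)
    (hψ : IsSlowWeight ψ) {α : ℝ} (hα : 1 ≤ α) :
    ∃ (F : ℝ → ℝ) (A : ℝ), IsGauge F A ∧ (∀ x : I, (powMul α φ ψ x : ℝ) = F x) ∧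
      Continuous (powMul α φ ψ) := by
  obtain ⟨A, hA⟩ := (hφ.mul hψ).exists_isGauge hα
  refine ⟨_, A, hA, fun x => ?_, ?_⟩
  · rw [realExt_coe, powMul]
    push_cast
    rw [mul_assoc]
    rfl
  · refine ((Continuous.comp (NNReal.continuous_rpow_const (zero_le_one.trans hα)) ?_).mul
      hφ.cont).mul hψ.cont
    exact Continuous.subtype_mk continuous_subtype_val _

section Interp

variable {δ : ℕ → ℝ} {k : ℕ → ℕ} {d : ℝ} {U V : Set ℕ} {ψ ψ' : I → ℝ≥0}

/-- The sequences are comparable at 2^(-n), and between neighbouring dyadic points monotonicity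
loses only a factor d², since even passing from n to 2n + 2 costs no more. -/
theorem exists_interp_le_mul (hδ : ∀ m, δ m ∈ Set.Ioo (0 : ℝ) 1) (hd : 0 < d)
    (hdδ : ∀ m, d ≤ δ m) (hk : StrictMono k) (hk2 : ∀ m, 2 ≤ k m)
    (hkd : ∀ m, 2 * k m ≤ k (m + 1)) (hm : Monotone ψ)
    (hi : ∀ n, (ψ (dyadicPt n) : ℝ) = blockSeq δ k U n) (hm' : Monotone ψ')
    (hi' : ∀ n, (ψ' (dyadicPt n) : ℝ) = blockSeq δ k V n) (h : AlmostSubset U V) :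
    ∃ C : ℝ≥0, ∀ x : I, 0 < x → ψ' x ≤ C * ψ x := by
  obtain ⟨C, hC, hCle⟩ := exists_blockSeq_le_mul hδ hd hdδ hk hk2 h
  refine ⟨⟨C * (d ^ 2)⁻¹, by positivity⟩, fun x hx => ?_⟩
  obtain ⟨n, h1, h2⟩ := exists_dyadic_bounds (t := x) hx x.2.2
  have h3 : ψ (dyadicPt (2 * n + 2)) ≤ ψ x := hm (Subtype.coe_le_coe.1 (by
    rw [coe_dyadicPt]
    exact (pow_le_pow_of_le_one (by norm_num) (by norm_num) (by omega)).trans h1.le))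
  have h4 : ψ' x ≤ ψ' (dyadicPt n) := hm' (Subtype.coe_le_coe.1 (by rwa [coe_dyadicPt]))
  rw [← NNReal.coe_le_coe] at h3 h4 ⊢
  rw [hi] at h3
  rw [hi'] at h4
  have h5 : blockSeq δ k U n ≤ (d ^ 2)⁻¹ * ψ x := by
    rw [inv_mul_eq_div, le_div_iff₀ (by positivity), mul_comm]
    exact (sq_mul_blockSeq_le hδ hd hdδ hk hk2 hkd U n).trans h3
  calc (ψ' x : ℝ) ≤ blockSeq δ k V n := h4
    _ ≤ C * blockSeq δ k U n := hCle n
    _ ≤ C * ((d ^ 2)⁻¹ * ψ x) := by gcongr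
    _ = _ := by rw [← mul_assoc]; rfl

end Interp

theorem powMul_le_mul {α : ℝ} (hα : 1 ≤ α) {φ ψ ψ' : I → ℝ≥0} {C : ℝ≥0}
    (h : ∀ x : I, 0 < x → ψ' x ≤ C * ψ x) (x : I) : powMul α φ ψ' x ≤ C * powMul α φ ψ x := by
  rcases eq_or_lt_of_le (show (0 : I) ≤ x from x.2.1) with rfl | hx
  · have : unitInterval.toNNReal 0 = 0 := rfl
    simp [powMul, this, NNReal.zero_rpow (zero_lt_one.trans_le hα).ne']
  · calc powMul α φ ψ' x ≤ unitInterval.toNNReal x ^ α * φ x * (C * ψ x) := by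
          rw [powMul]; gcongr; exact h x hx
      _ = _ := by rw [powMul]; ring

theorem powMul_dyadicPt (α : ℝ) (φ ψ : I → ℝ≥0) (n : ℕ) :
    (powMul α φ ψ (dyadicPt n) : ℝ) =
      ((1 / 2 : ℝ) ^ n) ^ α * φ (dyadicPt n) * ψ (dyadicPt n) := by
  rw [powMul]
  push_cast
  rw [← coe_dyadicPt]
  rfl

theorem mainTheorem3
    (α : ℝ) (hα : 1 ≤ α)
    (δ : ℕ → ℝ) (hδ : ∀ m, δ m ∈ Set.Ioo (0 : ℝ) 1)
    (hδ_inf : 0 < ⨅ m, δ m) (hδ_sup : (⨆ m, δ m) < 1)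
    (k : ℕ → ℕ) (hk_mono : StrictMono k) (hk_two : ∀ m, 2 ≤ k m)
    (hk_double : ∀ m, 2 * k m ≤ k (m + 1))
    (φ : I → ℝ≥0) (hφ_cont : Continuous φ) (hφ_inc : EssentiallyIncreasing φ)
    (hφ_pos : ∀ x : I, 0 < x → 0 < φ x)
    (hφ_sq : ∃ c : ℝ≥0, 0 < c ∧ ∀ x : I, c * φ x ≤ φ (x ^ 2))
    (ψ : Set ℕ → I → ℝ≥0) (hψ_cont : ∀ U, Continuous (ψ U)) (hψ_mono : ∀ U, Monotone (ψ U))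
    (hψ_interp : ∀ U n, (ψ U (dyadicPt n) : ℝ) = blockSeq δ k U n) :
    (∀ U, Equivalence (relE (powMul α φ (ψ U)))) ∧
    ∀ U V : Set ℕ,
      (AlmostSubset U V ↔
        BorelReducible (relE (powMul α φ (ψ U))) (relE (powMul α φ (ψ V)))) ∧
      (AlmostSubset U V → AlmostSubset V U →
        relE (powMul α φ (ψ U)) = relE (powMul α φ (ψ V))) ∧
      (AlmostSubset U V → (V \ U).Infinite →
        StrictlyBorelReducible (relE (powMul α φ (ψ U))) (relE (powMul α φ (ψ V)))) ∧
      ((U \ V).Infinite → (V \ U).Infinite →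
        BorelIncomparable (relE (powMul α φ (ψ U))) (relE (powMul α φ (ψ V)))) := by
  have hd : ∀ m, ⨅ m, δ m ≤ δ m := fun m =>
    ciInf_le ⟨0, by rintro _ ⟨m, rfl⟩; exact (hδ m).1.le⟩ m
  have hs : ∀ m, δ m ≤ ⨆ m, δ m := fun m =>
    le_ciSup (f := δ) ⟨1, by rintro _ ⟨m, rfl⟩; exact (hδ m).2.le⟩ m
  have hφ : IsSlowWeight φ := ⟨hφ_cont, hφ_pos, hφ_inc, hφ_sq⟩
  have hψ : ∀ U, IsSlowWeight (ψ U) := fun U => isSlowWeight_of_interp hδ hδ_inf hd hk_mono hk_two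
    hk_double (hψ_cont U) (hψ_mono U) (hψ_interp U)
  choose F A hF hFf hcont using fun U => hφ.exists_isGauge_powMul (hψ U) hα
  have hle : ∀ U V, AlmostSubset U V → ∀ x y, relE (powMul α φ (ψ U)) x y →
      relE (powMul α φ (ψ V)) x y := by
    intro U V h x y hxy
    obtain ⟨C, hC⟩ := exists_interp_le_mul hδ hδ_inf hd hk_mono hk_two hk_double (hψ_mono U)
      (hψ_interp U) (hψ_mono V) (hψ_interp V) h
    exact relE_of_le_mul (powMul_le_mul hα hC) hxy
  have heq : ∀ U V, AlmostSubset U V → AlmostSubset V U →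
      relE (powMul α φ (ψ U)) = relE (powMul α φ (ψ V)) := fun U V h h' => by
    funext x y
    exact propext ⟨hle U V h x y, hle V U h' x y⟩
  have hpos : ∀ V n, blockSeq δ k V n ≠ 0 := fun V n => (blockSeq_pos hδ hk_mono hk_two V n).ne'
  have hred : ∀ U V, AlmostSubset U V →
      BorelReducible (relE (powMul α φ (ψ U))) (relE (powMul α φ (ψ V))) := by
    intro U V h
    -- U and U ∩ V differ by a finite set, so they define the same relation; the true inclusion U ∩
    -- V ⊆ V makes the ratio increasing.
    rw [heq U (U ∩ V) (by rwa [AlmostSubset, Set.sdiff_self_inter])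
      (by rw [AlmostSubset, Set.sdiff_eq_empty.2 Set.inter_subset_left]; exact Set.finite_empty)]
    refine borelReducible_of_ratio (w := fun n => blockSeq δ k (U ∩ V) n / blockSeq δ k V n)
      ((hF _).weaken (le_max_left _ (A V))) (hFf _) ((hF V).weaken (le_max_right _ _)) (hFf V)
      (by simp [blockSeq]) (sub_pos.2 hδ_sup)
      (blockSeq_div_succ hδ hδ_sup hs hk_mono hk_two Set.inter_subset_right) fun n => ?_
    rw [← coe_dyadicPt, ← hFf, ← hFf, powMul_dyadicPt, powMul_dyadicPt, hψ_interp, hψ_interp]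
    have := hpos V n
    field_simp
  have hnot : ∀ U V, ¬ AlmostSubset U V →
      ¬ BorelReducible (relE (powMul α φ (ψ U))) (relE (powMul α φ (ψ V))) := by
    intro U V h
    refine not_borelReducible_of_liminf ?_ ?_ (hcont V) (hF V) (hFf V) fun ε hε => ?_
    · rw [← NNReal.coe_eq_zero, hFf]
      exact (hF U).zero
    · rw [← NNReal.coe_pos, hFf]
      exact (hF U).pos _ (by simp)
    -- At 2^(-n) the factors x^α φ(x) are common to both functions, so only u_U and u_V are
    -- compared.
    · obtain ⟨n, hn⟩ := exists_blockSeq_le_eps_mul hδ hδ_inf hd hδ_sup hs hk_mono hk_two h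
        (NNReal.coe_pos.2 hε)
      refine ⟨n, ?_⟩
      rw [← NNReal.coe_le_coe]
      push_cast
      rw [powMul_dyadicPt, powMul_dyadicPt, hψ_interp, hψ_interp]
      calc _ ≤ ((1 / 2 : ℝ) ^ n) ^ α * φ (dyadicPt n) * (ε * blockSeq δ k V n) := by gcongr
        _ = _ := by ring
  refine ⟨fun U => ((hF U).isQuasiDist (hFf U)).equivalence_relE, fun U V =>
    ⟨⟨hred U V, fun h => by_contra fun h' => hnot U V h' h⟩, heq U V,
      fun h h' => ⟨hred U V h, hnot V U h'⟩, fun h h' => ⟨hnot U V h, hnot V U h'⟩⟩⟩
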